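/- Consider the following decision problem (SDM). The input is a finite simple bipartite graph $G$ with parts $X=\{x_1,\dots,x_m\}$ and $Y=\{y_1,\dots,y_n\}$ (possibly empty), together with a set $S\subseteq X$. The question is whether $G$ has an \emph{$S$-pair}, that is, two matchings $M_1,M_2\subseteq E(G)$ with $M_1\cap M_2=\emptyset$ such that $M_1$ covers every vertex of $X$ and $M_2$ covers every vertex of $S$. \textbf{Theorem.} SDM, restricted to instances with $|S|\ge |X|-1$, is solvable in polynomial time: there are a multi-stack Turing machine (finitely many stacks, finite control) and a polynomial $p$ such that, for every instance $(G,S)$ with $|S|\ge|X|-1$, encoded as a word $w$ that consists of $|Y|$ in unary and the bipartite adjacency matrix of $G$ with an additional column for membership in $S$, the machine started on $w$ halts after at most $p(|w|)$ steps and outputs whether $G$ has an $S$-pair. Moreover, for every such instance, $G$ has an $S$-pair if and only if $G$ has a subgraph $H$ with $d_H(x)=1$ for all $x\in X\setminus S$, $d_H(x)=2$ for all $x\in S$, and $d_H(y)\le 2$ for all $y\in Y$ (a $(g,f)$-factor, where $f=1$ on $X\setminus S$, $f=2$ on $S\cup Y$, $g=f$ on $X$ and $g=0$ on $Y$). -/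

import Mathlib

/-- `G` has an `S`-pair with respect to the part `X`: two matchings `M₁, M₂` of `G` without common
edges such that `M₁` saturates `X` and `M₂` saturates `S`. -/
def HasSPair {V : Type*} (G : SimpleGraph V) (X S : Set V) : Prop :=
  ∃ M₁ M₂ : G.Subgraph, M₁.IsMatching ∧ M₂.IsMatching ∧
    Disjoint M₁.edgeSet M₂.edgeSet ∧ X ⊆ M₁.verts ∧ S ⊆ M₂.verts

/-- `H` is a `(g, f)`-factor of the finite graph `G`: a subgraph with
`g v ≤ d_H(v) ≤ f v` for every vertex `v` of `G`. -/
def IsFactor {V : Type*} [Finite V] {G : SimpleGraph V} (g f : V → ℕ) (H : G.Subgraph) : Prop :=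
  ∀ v, g v ≤ (H.neighborSet v).ncard ∧ (H.neighborSet v).ncard ≤ f v

/-- An instance of Single-Graph Disjoint Matchings: a finite simple bipartite graph with parts
`X = {x₀, …, x_{m-1}}` (the left summand) and `Y = {y₀, …, y_{n-1}}` (the right summand), and a
set `S ⊆ X`. -/
structure SDMInstance where
  m : ℕ
  n : ℕ
  graph : SimpleGraph (Fin m ⊕ Fin n)
  bipartite : graph.IsBipartiteWith (Set.range Sum.inl) (Set.range Sum.inr)
  S : Finset (Fin m)

namespace SDMInstance

/-- The part `X`, as a set of vertices. -/
def X (I : SDMInstance) : Set (Fin I.m ⊕ Fin I.n) := Set.range Sum.inl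

/-- The set `S`, as a set of vertices. -/
def SV (I : SDMInstance) : Set (Fin I.m ⊕ Fin I.n) := Sum.inl '' (I.S : Set (Fin I.m))

/-- The instance is a yes-instance of SDM. -/
def IsYes (I : SDMInstance) : Prop := HasSPair I.graph I.X I.SV

/-- The restriction `|S| ≥ |X| - 1`. -/
def IsLarge (I : SDMInstance) : Prop := I.m ≤ I.S.card + 1

/-- The upper degree bound: `1` on `X - S`, and `2` on `S` and on `Y`. -/
def upper (I : SDMInstance) : Fin I.m ⊕ Fin I.n → ℕ
  | .inl i => if i ∈ I.S then 2 else 1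
  | .inr _ => 2

/-- The lower degree bound: equal to the upper bound on `X`, and `0` on `Y`. -/
def lower (I : SDMInstance) : Fin I.m ⊕ Fin I.n → ℕ
  | .inl i => I.upper (.inl i)
  | .inr _ => 0

open Classical in
/-- The row of the vertex `xᵢ`: a bit that tells whether `xᵢ ∈ S`, then for each `yⱼ` a bit that
tells whether `xᵢyⱼ` is an edge, then the separator `none`. -/
noncomputable def encodeRow (I : SDMInstance) (i : Fin I.m) : List (Option Bool) :=
  some (decide (i ∈ I.S)) ::
    (List.ofFn (fun j : Fin I.n => some (decide (I.graph.Adj (.inl i) (.inr j)))) ++ [none])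

/-- The encoding of an instance as a word over the alphabet `{0, 1, separator}`: the number `|Y|` in
unary and a separator, followed by the rows of the vertices of `X`, that is by the bipartite
adjacency matrix with one extra column for `S`. -/
noncomputable def encode (I : SDMInstance) : List (Option Bool) :=
  (List.replicate I.n (some true) ++ [none]) ++ (List.ofFn I.encodeRow).flatten

theorem length_encodeRow (I : SDMInstance) (i : Fin I.m) :
    (I.encodeRow i).length = I.n + 2 := by
  simp [encodeRow]

theorem length_encode (I : SDMInstance) :
    I.encode.length = (I.n + 1) + I.m * (I.n + 2) := by
  simp [encode, List.length_flatten, List.map_ofFn, Function.comp_def, length_encodeRow]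
  ring

/-- No information is lost in the encoding. -/
theorem encode_injective : Function.Injective encode := by
  intro I J h
  have hn : I.n = J.n := by
    have key : ∀ K : SDMInstance, K.encode.takeWhile Option.isSome
        = List.replicate K.n (some true) := by
      intro K
      unfold encode
      rw [List.append_assoc, List.takeWhile_append_of_pos (by simp)]
      simp
    have h2 := congrArg (fun l => (l.takeWhile Option.isSome).length) h
    simpa [key] using h2
  have hm : I.m = J.m := by
    have h2 := congrArg List.length h
    rw [length_encode, length_encode, hn] at h2
    exact Nat.eq_of_mul_eq_mul_right (Nat.succ_pos _) (Nat.add_left_cancel h2)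
  obtain ⟨m, n, G, hG, S⟩ := I
  obtain ⟨m', n', G', hG', S'⟩ := J
  simp only at hn hm
  subst hn hm
  have h1 := List.append_cancel_left h
  have h2 : List.ofFn (encodeRow ⟨m, n, G, hG, S⟩) = List.ofFn (encodeRow ⟨m, n, G', hG', S'⟩) := by
    apply List.eq_iff_flatten_eq.2
    refine ⟨h1, ?_⟩
    simp [List.map_ofFn, Function.comp_def, length_encodeRow]
  have h3 := List.ofFn_injective h2
  have hS : S = S' := by
    ext i
    have := congrFun h3 i
    simp only [encodeRow, List.cons.injEq, Option.some.injEq, decide_eq_decide] at this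
    exact this.1
  have hadj : ∀ i j, G.Adj (.inl i) (.inr j) ↔ G'.Adj (.inl i) (.inr j) := by
    intro i j
    have := congrFun h3 i
    simp only [encodeRow, List.cons.injEq] at this
    have h4 := congrFun (List.ofFn_injective (List.append_cancel_right this.2)) j
    simpa using h4
  have hGG : G = G' := by
    ext a b
    rcases a with a | a <;> rcases b with b | b
    · constructor
      · intro h; simpa using hG.mem_of_adj h
      · intro h; simpa using hG'.mem_of_adj h
    · exact hadj a b
    · rw [G.adj_comm, G'.adj_comm]; exact hadj b a
    · constructor
      · intro h; simpa using hG.mem_of_adj h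
      · intro h; simpa using hG'.mem_of_adj h
  subst hS hGG
  rfl

open Classical in
/-- The answer to be computed on an instance with `|S| ≥ |X| - 1`. -/
noncomputable def answer (I : {I : SDMInstance // I.IsLarge}) : Bool := decide I.1.IsYes

end SDMInstance

/-!
Splitting a factor into matchings: if `S` misses at most one vertex of `X`, then an `S`-pair exists
if and only if there is a set of edges with degree `2` at the vertices of `S`, degree `1` at the vertex outside `S`
(if there is one), and degree at most `2` on `Y`. The two matchings of an `S`-pair give such a set,
after dropping superfluous edges (`SDMInstance.IsYes.exists_isSolution`). Conversely such a set is
completed to a nonnegative integer matrix with all row and column sums equal to `2`; by Hall's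
theorem its support contains a permutation (`exists_equiv_of_sum_eq`), and the edges on and off that
permutation are two disjoint matchings. Both cover `S`. The vertex outside `S` is covered by exactly
one of them, and that one is taken to be `M₁`; this is where `|S| ≥ |X| - 1` is needed
(`SDMInstance.isYes_of_isFactor`).

Deciding the existence of a factor: a push-relabel algorithm (`DegreeFlow.Step`) keeps a set of
chosen edges and a level for every vertex of `X`. A vertex of `X` with too few edges takes a free
place at a neighbour, or takes the place of a vertex of smaller level; if both are impossible, its
level increases. If a factor exists, then a counting argument at an unattained level shows that the
level of a vertex with too few edges stays below `|X|` (`DegreeFlow.Inv.lev_lt`). So a potential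
that grows with every step is bounded by `3 |X| ^ 2 + 2 |X|`, and after more than that many rounds
all vertices have enough edges (`DegreeFlow.Reached.satisfied`).

Running time: the algorithm is written in a language of loop programs (`StackProgram.Prog`) in which
every loop is executed `N` times, where `N` is the length of the input, and the data are a finite
control state, registers with values up to `N`, and a two-dimensional array over a finite alphabet.
Such a program compiles to a structured stack program (`StackProgram.Cmd`) and then to a machine of
Mathlib's model of multi-stack Turing machines, with a step count that is bounded by a polynomial in
`N` (`StackProgram.Prog.nonempty_tm2ComputableInPolyTime`). A register is kept as two unary stacks
whose heights add up to `N`, and the array is kept row by row on a pair of stacks. The correctness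
of the concrete program is `SDMProgram.main_correct`.
-/

/-! ### Structured programs for stack machines -/

namespace StackProgram

open Turing

variable {K : Type} {Γ : K → Type} {σ : Type}

/-- Structured programs over a family of stacks `k : K` with alphabets `Γ k` and a finite local
store `σ`. -/
inductive Cmd (Γ : K → Type) (σ : Type) : Type
  | push (k : K) (g : σ → Γ k)
  | pop (k : K) (f : σ → Option (Γ k) → σ)
  | peek (k : K) (f : σ → Option (Γ k) → σ)
  | load (f : σ → σ)
  | seq (a b : Cmd Γ σ)
  | ite (p : σ → Bool) (a b : Cmd Γ σ)
  | loop (p : σ → Bool) (a : Cmd Γ σ)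

/-- A store together with the contents of all stacks. -/
abbrev State (Γ : K → Type) (σ : Type) : Type := σ × (∀ k, List (Γ k))

namespace Cmd

/-- `Runs c s s' t`: the program `c`, started in `s`, ends in `s'` after exactly `t` machine
steps. -/
inductive Runs [DecidableEq K] : Cmd Γ σ → State Γ σ → State Γ σ → ℕ → Prop
  | push (k g v S) : Runs (.push k g) (v, S) (v, Function.update S k (g v :: S k)) 1
  | pop (k f v S) :
      Runs (.pop k f) (v, S) (f v (S k).head?, Function.update S k (S k).tail) 1
  | peek (k f v S) : Runs (.peek k f) (v, S) (f v (S k).head?, S) 1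
  | load (f v S) : Runs (.load f) (v, S) (f v, S) 1
  | seq {a b s₁ s₂ s₃ t₁ t₂} : Runs a s₁ s₂ t₁ → Runs b s₂ s₃ t₂ →
      Runs (.seq a b) s₁ s₃ (t₁ + t₂)
  | ite_true {p a b s s' t} : p s.1 = true → Runs a s s' t → Runs (.ite p a b) s s' (t + 1)
  | ite_false {p a b s s' t} : p s.1 = false → Runs b s s' t → Runs (.ite p a b) s s' (t + 1)
  | loop_done {p a s} : p s.1 = false → Runs (.loop p a) s s 1
  | loop_step {p a s₁ s₂ s₃ t₁ t₂} : p s₁.1 = true → Runs a s₁ s₂ t₁ →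
      Runs (.loop p a) s₂ s₃ t₂ → Runs (.loop p a) s₁ s₃ (t₁ + t₂ + 1)

/-- The control points of a program. -/
def Label : Cmd Γ σ → Type
  | .push _ _ => Unit
  | .pop _ _ => Unit
  | .peek _ _ => Unit
  | .load _ => Unit
  | .seq a b => Label a ⊕ Label b
  | .ite _ a b => Option (Label a ⊕ Label b)
  | .loop _ a => Option (Label a)

instance instFintypeLabel : (c : Cmd Γ σ) → Fintype (Label c)
  | .push _ _ => inferInstanceAs (Fintype Unit)
  | .pop _ _ => inferInstanceAs (Fintype Unit)
  | .peek _ _ => inferInstanceAs (Fintype Unit)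
  | .load _ => inferInstanceAs (Fintype Unit)
  | .seq a b =>
    letI := instFintypeLabel a
    letI := instFintypeLabel b
    inferInstanceAs (Fintype (Label a ⊕ Label b))
  | .ite _ a b =>
    letI := instFintypeLabel a
    letI := instFintypeLabel b
    inferInstanceAs (Fintype (Option (Label a ⊕ Label b)))
  | .loop _ a =>
    letI := instFintypeLabel a
    inferInstanceAs (Fintype (Option (Label a)))

/-- The control point at which a program starts. -/
def entry : (c : Cmd Γ σ) → Label c
  | .push _ _ => ()
  | .pop _ _ => ()
  | .peek _ _ => ()
  | .load _ => ()
  | .seq a _ => Sum.inl (entry a)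
  | .ite _ _ _ => (none : Option _)
  | .loop _ _ => (none : Option _)

/-- The machine code of a program whose control points are placed at `emb` and which continues at
`exit`. -/
def code {Λ : Type} : (c : Cmd Γ σ) → (Label c → Λ) → Λ → Label c → TM2.Stmt Γ Λ σ
  | .push k g, _, exit, _ => .push k g (.goto fun _ => exit)
  | .pop k f, _, exit, _ => .pop k f (.goto fun _ => exit)
  | .peek k f, _, exit, _ => .peek k f (.goto fun _ => exit)
  | .load f, _, exit, _ => .load f (.goto fun _ => exit)
  | .seq a b, emb, _, Sum.inl l =>
    code a (fun l => emb (Sum.inl l)) (emb (Sum.inr (entry b))) l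
  | .seq _ b, emb, exit, Sum.inr l => code b (fun l => emb (Sum.inr l)) exit l
  | .ite p a b, emb, _, none =>
    .branch p (.goto fun _ => emb (some (Sum.inl (entry a))))
      (.goto fun _ => emb (some (Sum.inr (entry b))))
  | .ite _ a _, emb, exit, some (Sum.inl l) => code a (fun l => emb (some (Sum.inl l))) exit l
  | .ite _ _ b, emb, exit, some (Sum.inr l) => code b (fun l => emb (some (Sum.inr l))) exit l
  | .loop p a, emb, exit, none =>
    .branch p (.goto fun _ => emb (some (entry a))) (.goto fun _ => exit)
  | .loop _ a, emb, _, some l => code a (fun l => emb (some l)) (emb none) l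

variable [DecidableEq K]

/-- A run of a program is a run of every machine that contains its code. -/
theorem Runs.iterate_step {c : Cmd Γ σ} {s s' : State Γ σ} {t : ℕ} (h : Runs c s s' t) {Λ : Type}
    (M : Λ → TM2.Stmt Γ Λ σ) (emb : Label c → Λ) (exit : Λ)
    (hM : ∀ l, M (emb l) = code c emb exit l) :
    (flip bind (TM2.step M))^[t] (some ⟨some (emb (entry c)), s.1, s.2⟩) =
      some ⟨some exit, s'.1, s'.2⟩ := by
  induction h generalizing exit with
  | push | pop | peek | load =>
    simp [flip, hM, code]
  | seq _ _ iha ihb =>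
    rw [add_comm, Function.iterate_add_apply]
    refine Eq.trans (congrArg _ (iha (fun l => emb (Sum.inl l)) _ fun l => hM (Sum.inl l))) ?_
    exact ihb (fun l => emb (Sum.inr l)) _ fun l => hM (Sum.inr l)
  | ite_true hp _ ih =>
    rw [Function.iterate_succ_apply, ← ih (fun l => emb (some (Sum.inl l))) exit
      fun l => hM (some (Sum.inl l))]
    have := hM none
    simp [flip, entry, this, code, hp]
  | ite_false hp _ ih =>
    rw [Function.iterate_succ_apply, ← ih (fun l => emb (some (Sum.inr l))) exit
      fun l => hM (some (Sum.inr l))]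
    have := hM none
    simp [flip, entry, this, code, hp]
  | loop_done hp =>
    have := hM none
    simp [flip, entry, this, code, hp]
  | @loop_step p a s₁ s₂ s₃ t₁ t₂ hp _ _ iha ihb =>
    have h0 := hM none
    rw [Function.iterate_succ_apply, add_comm, Function.iterate_add_apply]
    refine Eq.trans (congrArg _ ?_) (ihb emb exit hM)
    refine Eq.trans ?_ (iha (fun l => emb (some l)) (emb none) fun l => hM (some l))
    simp [flip, entry, h0, code, hp]

/-- The machine that runs a program and halts. -/
def machine [Fintype K] [Fintype σ] (c : Cmd Γ σ) (k₀ k₁ : K) (v : σ) [Fintype (Γ k₀)] :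
    FinTM2 where
  K := K
  k₀ := k₀
  k₁ := k₁
  Γ := Γ
  Λ := Option (Label c)
  main := some (entry c)
  σ := σ
  initialState := v
  m
    | none => .halt
    | some l => code c some none l

theorem Runs.iterate_machine [Fintype K] [Fintype σ] {c : Cmd Γ σ} {s s' : State Γ σ} {t : ℕ}
    (h : Runs c s s' t) (k₀ k₁ : K) (v : σ) [Fintype (Γ k₀)] :
    (flip bind (machine c k₀ k₁ v).step)^[t + 1] (some ⟨some (some (entry c)), s.1, s.2⟩) =
      some ⟨none, s'.1, s'.2⟩ := by
  rw [Function.iterate_succ_apply']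
  have := h.iterate_step (machine c k₀ k₁ v).m some none fun _ => rfl
  exact Eq.trans (congrArg _ this) rfl

end Cmd

end StackProgram

/-! ### Loop programs with a two-dimensional memory -/

namespace StackProgram

open Cmd Polynomial

/-- Loop programs with registers `V`, finite control state `Q` and a two-dimensional memory with
cells in `G`. Registers hold numbers up to the length `N` of the input; every loop is executed
exactly `N` times. -/
inductive Prog (V Q G : Type) : Type
  | load (f : Q → Q)
  | read (f : Q → Option (Option Bool) → Q)
  | act (i j : V) (f : Q → G → Q × G)
  | inc (v : V)
  | clr (v : V)
  | seq (a b : Prog V Q G)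
  | ite (p : Q → Bool) (a b : Prog V Q G)
  | each (v : V) (a : Prog V Q G)

/-- The data on which a loop program operates: control state, registers, memory, and the part of
the input that has not been read. -/
structure Env (V Q G : Type) where
  q : Q
  reg : V → ℕ
  mem : ℕ → ℕ → G
  inp : List (Option Bool)

namespace Prog

variable {V Q G : Type} [DecidableEq V]

/-- `a.Keeps v`: the program does not assign to the register `v`. -/
def Keeps (v : V) : Prog V Q G → Prop
  | load _ => True
  | read _ => True
  | act _ _ _ => True
  | inc u => u ≠ v
  | clr u => u ≠ v
  | seq a b => a.Keeps v ∧ b.Keeps v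
  | ite _ a b => a.Keeps v ∧ b.Keeps v
  | each u a => u ≠ v ∧ a.Keeps v

/-- No loop body assigns to the register that counts the loop. -/
def WellFormed : Prog V Q G → Prop
  | seq a b => a.WellFormed ∧ b.WellFormed
  | ite _ a b => a.WellFormed ∧ b.WellFormed
  | each v a => a.Keeps v ∧ a.WellFormed
  | _ => True

/-- The effect of a program for inputs of length `N`. -/
def eval (N : ℕ) : Prog V Q G → Env V Q G → Env V Q G
  | load f, e => { e with q := f e.q }
  | read f, e => { e with q := f e.q e.inp.head?, inp := e.inp.tail }
  | act i j f, e =>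
    { e with
      q := (f e.q (e.mem (e.reg i) (e.reg j))).1
      mem := Function.update e.mem (e.reg i) (Function.update (e.mem (e.reg i)) (e.reg j)
        (f e.q (e.mem (e.reg i) (e.reg j))).2) }
  | inc v, e => { e with reg := Function.update e.reg v (min (e.reg v + 1) N) }
  | clr v, e => { e with reg := Function.update e.reg v 0 }
  | seq a b, e => eval N b (eval N a e)
  | ite p a b, e => if p e.q then eval N a e else eval N b e
  | each v a, e =>
    (fun e => { eval N a e with
      reg := Function.update (eval N a e).reg v (min ((eval N a e).reg v + 1) N) })^[N]
      { e with reg := Function.update e.reg v 0 }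

theorem Keeps.reg_eval {N : ℕ} {v : V} {p : Prog V Q G} (h : p.Keeps v) (e : Env V Q G) :
    (p.eval N e).reg v = e.reg v := by
  induction p generalizing e with
  | load | read | act => rfl
  | inc u | clr u => simp [eval, Function.update_of_ne (Ne.symm h)]
  | seq a b iha ihb => rw [eval, ihb h.2, iha h.1]
  | ite p a b iha ihb =>
    simp only [eval]
    split_ifs
    exacts [iha h.1 e, ihb h.2 e]
  | each u a iha =>
    simp only [eval]
    have key : ∀ n : ℕ, ∀ e : Env V Q G, ((fun e => { eval N a e with
      reg := Function.update (eval N a e).reg u (min ((eval N a e).reg u + 1) N) })^[n] e).reg v =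
        e.reg v := by
      intro n
      induction n with
      | zero => intro e; rfl
      | succ n ih =>
        intro e
        rw [Function.iterate_succ_apply, ih]
        simp [Function.update_of_ne (Ne.symm h.1), iha h.2]
    rw [key]
    simp [Function.update_of_ne (Ne.symm h.1)]

/-- A bound for the number of machine steps, as a polynomial in the length of the input. -/
noncomputable def time : Prog V Q G → Polynomial ℕ
  | load _ => 1
  | read _ => 1
  | act _ _ _ => 14 * X ^ 2 + 32 * X + 12
  | inc _ => 4
  | clr _ => 4 * X + 2
  | seq a b => a.time + b.time
  | ite _ a b => a.time + b.time + 1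
  | each _ a => X * (a.time + 6) + 2 + (4 * X + 2)

end Prog

/-- The stacks on which a loop program is run. A register `v` with value `i ≤ N` is kept as `i`
tokens on `dn v` and `N - i` tokens on `rm v`; the index `none` is a register that is always `0`
and so provides the number `N`. The memory is kept on `right`, row by row. -/
inductive Stack (V : Type) : Type
  | inp | sav | out | dn (v : Option V) | rm (v : Option V) | tmp | left | right
  deriving DecidableEq, Fintype

/-- The stack alphabets. -/
abbrev Stack.Alph {V : Type} (G : Type) : Stack V → Type
  | inp => Option Bool
  | sav => Option Bool
  | out => Bool
  | dn _ => Unit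
  | rm _ => Unit
  | tmp => Unit
  | left => G
  | right => G

/-- The local store: the control state of the program, and scratch space for a cell, a flag and an
input symbol. -/
abbrev Store (Q G : Type) : Type := Q × G × Bool × Option Bool

/-- The control state of a program together with the stack contents. -/
structure Conf (V Q G : Type) where
  q : Q
  inp : List (Option Bool)
  sav : List (Option Bool)
  out : List Bool
  dn : Option V → ℕ
  rm : Option V → ℕ
  tmp : ℕ
  left : List G
  right : List G

section Compile

variable {V Q G : Type}

/-- The stack contents of a configuration. -/
def Conf.stk (a : Conf V Q G) : ∀ k : Stack V, List (k.Alph G)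
  | .inp => a.inp
  | .sav => a.sav
  | .out => a.out
  | .dn v => List.replicate (a.dn v) ()
  | .rm v => List.replicate (a.rm v) ()
  | .tmp => List.replicate a.tmp ()
  | .left => a.left
  | .right => a.right

variable [DecidableEq V]

/-- `Sim c a a' T`: whatever the scratch space, `c` leads from `a` to `a'` in at most `T` steps. -/
def Sim (c : Cmd (Stack.Alph (V := V) G) (Store Q G)) (a a' : Conf V Q G) (T : ℕ) : Prop :=
  ∀ s, ∃ s' t, t ≤ T ∧ Runs c ((a.q, s), a.stk) ((a'.q, s'), a'.stk) t

variable {c c₁ c₂ : Cmd (Stack.Alph (V := V) G) (Store Q G)} {a a₁ a₂ a₃ : Conf V Q G}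
  {T T₁ T₂ : ℕ}

theorem Sim.mono (h : Sim c a₁ a₂ T₁) (hT : T₁ ≤ T₂) : Sim c a₁ a₂ T₂ := fun s =>
  let ⟨s', t, ht, hr⟩ := h s
  ⟨s', t, ht.trans hT, hr⟩

theorem Sim.of_eq (h : Sim c a₁ a₂ T) (e : a₂ = a₃) : Sim c a₁ a₃ T := e ▸ h

theorem Sim.seq (h₁ : Sim c₁ a₁ a₂ T₁) (h₂ : Sim c₂ a₂ a₃ T₂) :
    Sim (c₁.seq c₂) a₁ a₃ (T₁ + T₂) := fun s =>
  let ⟨s', t, ht, hr⟩ := h₁ s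
  let ⟨s'', t', ht', hr'⟩ := h₂ s'
  ⟨s'', t + t', add_le_add ht ht', hr.seq hr'⟩

/-- Record in the scratch flag whether the stack `k` is nonempty. -/
def test (k : Stack V) : Cmd (Stack.Alph (V := V) G) (Store Q G) :=
  .peek k fun s o => (s.1, s.2.1, o.isSome, s.2.2.2)

/-- Repeat `c` while the stack `k` is nonempty. -/
def whileNonempty (k : Stack V) (c : Cmd (Stack.Alph (V := V) G) (Store Q G)) :
    Cmd (Stack.Alph (V := V) G) (Store Q G) :=
  .seq (test k) (.loop (fun s => s.2.2.1) (.seq c (test k)))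

/-- Run `c` if the stack `k` is nonempty. -/
def whenNonempty (k : Stack V) (c : Cmd (Stack.Alph (V := V) G) (Store Q G)) :
    Cmd (Stack.Alph (V := V) G) (Store Q G) :=
  .seq (test k) (.ite (fun s => s.2.2.1) c (.load id))

/-- Rule for loops: `P i` is what holds before pass `i` of `n` passes. -/
theorem sim_whileNonempty (k : Stack V) (P : ℕ → Conf V Q G → Prop) (n : ℕ)
    (hne : ∀ i < n, ∀ a, P i a → a.stk k ≠ []) (hend : ∀ a, P n a → a.stk k = [])
    (hstep : ∀ i < n, ∀ a, P i a → ∃ a', P (i + 1) a' ∧ Sim c a a' T) (ha : P 0 a) :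
    ∃ a', P n a' ∧ Sim (whileNonempty k c) a a' (n * (T + 2) + 2) := by
  have key : ∀ d i, i + d = n → ∀ a, P i a → ∃ a', P n a' ∧ ∀ x s, ∃ s' t, t ≤ d * (T + 2) + 1 ∧
      Runs (.loop (fun s => s.2.2.1) (.seq c (test k)))
        ((a.q, x, (a.stk k).head?.isSome, s), a.stk) ((a'.q, s'), a'.stk) t := by
    intro d
    induction d with
    | zero =>
      rintro i rfl a ha
      exact ⟨a, ha, fun x s => ⟨_, 1, by omega, .loop_done (by simp [hend a ha])⟩⟩
    | succ d ih =>
      intro i hi a ha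
      obtain ⟨a₁, ha₁, hs⟩ := hstep i (by omega) a ha
      obtain ⟨a₂, ha₂, hr⟩ := ih (i + 1) (by omega) a₁ ha₁
      refine ⟨a₂, ha₂, fun x s => ?_⟩
      obtain ⟨s₁, t₁, ht₁, hr₁⟩ := hs (x, (a.stk k).head?.isSome, s)
      obtain ⟨s₂, t₂, ht₂, hr₂⟩ := hr s₁.1 s₁.2.2
      refine ⟨s₂, _, ?_, .loop_step ?_ (hr₁.seq (.peek _ _ _ _)) hr₂⟩
      · rw [add_mul]; omega
      · have := hne i (by omega) a ha
        simpa [List.isSome_head?, Option.isSome_iff_ne_none] using this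
  obtain ⟨a', ha', h⟩ := key n 0 (by simp) a ha
  refine ⟨a', ha', fun s => ?_⟩
  obtain ⟨s', t, ht, hr⟩ := h s.1 s.2.2
  exact ⟨s', _, by omega, .seq (.peek _ _ _ _) hr⟩

/-- The deterministic case of `sim_whileNonempty`. -/
theorem sim_whileNonempty_of_fun (k : Stack V) (b : ℕ → Conf V Q G) (n : ℕ)
    (hne : ∀ i < n, (b i).stk k ≠ []) (hend : (b n).stk k = [])
    (hstep : ∀ i < n, Sim c (b i) (b (i + 1)) T) :
    Sim (whileNonempty k c) (b 0) (b n) (n * (T + 2) + 2) := by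
  obtain ⟨a', rfl, h⟩ := sim_whileNonempty (c := c) (T := T) k (fun i a => a = b i) n
    (by rintro i hi _ rfl; exact hne i hi) (by rintro _ rfl; exact hend)
    (by rintro i hi _ rfl; exact ⟨_, rfl, hstep i hi⟩) rfl
  exact h

theorem Sim.whenNonempty {k : Stack V} (h : a.stk k ≠ []) (hs : Sim c a a' T) :
    Sim (whenNonempty k c) a a' (T + 2) := fun s => by
  obtain ⟨s', t, ht, hr⟩ := hs (s.1, (a.stk k).head?.isSome, s.2.2)
  exact ⟨s', _, by omega, .seq (.peek _ _ _ _)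
    (.ite_true (by simpa [List.isSome_head?, Option.isSome_iff_ne_none] using h) hr)⟩

theorem sim_whenNonempty_of_eq_nil {k : Stack V} (h : a.stk k = []) :
    Sim (StackProgram.whenNonempty k c) a a 3 := fun _ =>
  ⟨_, _, le_rfl, .seq (.peek _ _ _ _) (.ite_false (by simp [h]) (.load _ _ _))⟩

theorem Conf.update_dn (a : Conf V Q G) (v : Option V) (l : List (Stack.Alph G (.dn v))) :
    Function.update a.stk (.dn v) l =
      { a with dn := Function.update a.dn v l.length }.stk := by
  funext k
  cases k with
  | dn u =>
    rcases eq_or_ne u v with rfl | h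
    · simpa [Conf.stk] using List.eq_replicate_length.2 fun _ _ => rfl
    · simp [Conf.stk, h]
  | _ => simp [Conf.stk]

theorem Conf.update_rm (a : Conf V Q G) (v : Option V) (l : List (Stack.Alph G (.rm v))) :
    Function.update a.stk (.rm v) l =
      { a with rm := Function.update a.rm v l.length }.stk := by
  funext k
  cases k with
  | rm u =>
    rcases eq_or_ne u v with rfl | h
    · simpa [Conf.stk] using List.eq_replicate_length.2 fun _ _ => rfl
    · simp [Conf.stk, h]
  | _ => simp [Conf.stk]

theorem Conf.update_tmp (a : Conf V Q G) (l : List (Stack.Alph G (.tmp : Stack V))) :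
    Function.update a.stk .tmp l = { a with tmp := l.length }.stk := by
  funext k
  cases k with
  | tmp => simpa [Conf.stk] using List.eq_replicate_length.2 fun _ _ => rfl
  | _ => simp [Conf.stk]

theorem Conf.update_left (a : Conf V Q G) (l : List (Stack.Alph G (.left : Stack V))) :
    Function.update a.stk .left l = { a with left := l }.stk := by
  funext k
  cases k <;> simp [Conf.stk]

theorem Conf.update_right (a : Conf V Q G) (l : List (Stack.Alph G (.right : Stack V))) :
    Function.update a.stk .right l = { a with right := l }.stk := by
  funext k
  cases k <;> simp [Conf.stk]

theorem Conf.update_inp (a : Conf V Q G) (l : List (Stack.Alph G (.inp : Stack V))) :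
    Function.update a.stk .inp l = { a with inp := l }.stk := by
  funext k
  cases k <;> simp [Conf.stk]

theorem Conf.update_sav (a : Conf V Q G) (l : List (Stack.Alph G (.sav : Stack V))) :
    Function.update a.stk .sav l = { a with sav := l }.stk := by
  funext k
  cases k <;> simp [Conf.stk]

theorem sim_load (f : Q → Q) (a : Conf V Q G) :
    Sim (.load fun s => (f s.1, s.2)) a { a with q := f a.q } 1 := fun s =>
  ⟨s, 1, le_rfl, .load _ _ _⟩

theorem sim_pop_dn (a : Conf V Q G) (v : Option V) :
    Sim (.pop (.dn v) fun s _ => s) a { a with dn := Function.update a.dn v (a.dn v - 1) } 1 :=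
  fun s => ⟨s, 1, le_rfl, by
    have := Runs.pop (.dn v) (fun (s : Store Q G) _ => s) (a.q, s) a.stk
    rw [Conf.update_dn] at this
    simpa [Conf.stk] using this⟩

theorem sim_pop_rm (a : Conf V Q G) (v : Option V) :
    Sim (.pop (.rm v) fun s _ => s) a { a with rm := Function.update a.rm v (a.rm v - 1) } 1 :=
  fun s => ⟨s, 1, le_rfl, by
    have := Runs.pop (.rm v) (fun (s : Store Q G) _ => s) (a.q, s) a.stk
    rw [Conf.update_rm] at this
    simpa [Conf.stk] using this⟩

theorem sim_pop_tmp (a : Conf V Q G) :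
    Sim (.pop .tmp fun s _ => s) a { a with tmp := a.tmp - 1 } 1 :=
  fun s => ⟨s, 1, le_rfl, by
    have := Runs.pop .tmp (fun (s : Store Q G) _ => s) (a.q, s) a.stk
    rw [Conf.update_tmp] at this
    simpa [Conf.stk] using this⟩

theorem sim_push_dn (a : Conf V Q G) (v : Option V) :
    Sim (.push (.dn v) fun _ => ()) a { a with dn := Function.update a.dn v (a.dn v + 1) } 1 :=
  fun s => ⟨s, 1, le_rfl, by
    have := Runs.push (.dn v) (fun (_ : Store Q G) => ()) (a.q, s) a.stk
    rw [Conf.update_dn] at this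
    simpa [Conf.stk] using this⟩

theorem sim_push_rm (a : Conf V Q G) (v : Option V) :
    Sim (.push (.rm v) fun _ => ()) a { a with rm := Function.update a.rm v (a.rm v + 1) } 1 :=
  fun s => ⟨s, 1, le_rfl, by
    have := Runs.push (.rm v) (fun (_ : Store Q G) => ()) (a.q, s) a.stk
    rw [Conf.update_rm] at this
    simpa [Conf.stk] using this⟩

theorem sim_push_tmp (a : Conf V Q G) :
    Sim (.push .tmp fun _ => ()) a { a with tmp := a.tmp + 1 } 1 :=
  fun s => ⟨s, 1, le_rfl, by
    have := Runs.push .tmp (fun (_ : Store Q G) => ()) (a.q, s) a.stk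
    rw [Conf.update_tmp] at this
    simpa [Conf.stk] using this⟩

/-- Move a token from `dn v` to `rm v`. -/
def down (v : Option V) : Cmd (Stack.Alph (V := V) G) (Store Q G) :=
  .seq (.pop (.dn v) fun s _ => s) (.push (.rm v) fun _ => ())

/-- Move a token from `rm v` to `dn v`. -/
def up (v : Option V) : Cmd (Stack.Alph (V := V) G) (Store Q G) :=
  .seq (.pop (.rm v) fun s _ => s) (.push (.dn v) fun _ => ())

theorem sim_down (a : Conf V Q G) (v : Option V) :
    Sim (down v) a { a with
      dn := Function.update a.dn v (a.dn v - 1)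
      rm := Function.update a.rm v (a.rm v + 1) } 2 :=
  (sim_pop_dn a v).seq (sim_push_rm _ v)

theorem sim_up (a : Conf V Q G) (v : Option V) :
    Sim (up v) a { a with
      dn := Function.update a.dn v (a.dn v + 1)
      rm := Function.update a.rm v (a.rm v - 1) } 2 :=
  (sim_pop_rm a v).seq (sim_push_dn _ v)

/-- Assign `0` to a register. -/
def clear (v : Option V) : Cmd (Stack.Alph (V := V) G) (Store Q G) :=
  whileNonempty (.dn v) (down v)

theorem sim_clear (a : Conf V Q G) (v : Option V) :
    Sim (clear v) a { a with
      dn := Function.update a.dn v 0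
      rm := Function.update a.rm v (a.rm v + a.dn v) } (a.dn v * 4 + 2) := by
  have := sim_whileNonempty_of_fun (c := down v) (T := 2) (.dn v)
    (fun i => { a with
      dn := Function.update a.dn v (a.dn v - i)
      rm := Function.update a.rm v (a.rm v + i) }) (a.dn v)
    (fun i hi => by simp [Conf.stk]; omega) (by simp [Conf.stk])
    (fun i hi => (sim_down _ v).of_eq (by simp [Nat.sub_sub, add_assoc]))
  simpa [clear] using this

variable [Inhabited G]

/-- Move one cell to the right. Beyond the end of the tape there are blank cells. -/
def right : Cmd (Stack.Alph (V := V) G) (Store Q G) :=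
  .seq (.pop .right fun s o => (s.1, Option.getD o default, s.2.2)) (.push .left fun s => s.2.1)

/-- Move one cell to the left. -/
def left : Cmd (Stack.Alph (V := V) G) (Store Q G) :=
  .seq (.pop .left fun s o => (s.1, Option.getD o default, s.2.2)) (.push .right fun s => s.2.1)

theorem sim_right (a : Conf V Q G) :
    Sim right a { a with left := a.right.headD default :: a.left, right := a.right.tail } 2 :=
  fun s => ⟨_, 2, le_rfl, by
    have h₁ := Runs.pop .right (fun (s : Store Q G) o => (s.1, Option.getD o default, s.2.2))
      (a.q, s) a.stk
    rw [Conf.update_right] at h₁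
    have h₂ := h₁.seq (Runs.push .left (fun (s : Store Q G) => s.2.1) _ _)
    rw [Conf.update_left] at h₂
    simpa [right, Conf.stk, List.headD_eq_head?_getD] using h₂⟩

theorem sim_left (a : Conf V Q G) :
    Sim left a { a with right := a.left.headD default :: a.right, left := a.left.tail } 2 :=
  fun s => ⟨_, 2, le_rfl, by
    have h₁ := Runs.pop .left (fun (s : Store Q G) o => (s.1, Option.getD o default, s.2.2))
      (a.q, s) a.stk
    rw [Conf.update_left] at h₁
    have h₂ := h₁.seq (Runs.push .right (fun (s : Store Q G) => s.2.1) _ _)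
    rw [Conf.update_right] at h₂
    simpa [left, Conf.stk, List.headD_eq_head?_getD] using h₂⟩

/-- Move to the first cell. -/
def rewind : Cmd (Stack.Alph (V := V) G) (Store Q G) := whileNonempty .left left

theorem sim_rewind (a : Conf V Q G) :
    Sim rewind a { a with left := [], right := a.left.reverse ++ a.right }
      (a.left.length * 4 + 2) := by
  have := sim_whileNonempty_of_fun (c := left) (T := 2) .left
    (fun i => { a with
      left := a.left.drop i
      right := (a.left.take i).reverse ++ a.right }) a.left.length
    (fun i hi => by simp [Conf.stk]; omega) (by simp [Conf.stk])
    (fun i hi => (sim_left _).of_eq (by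
      simp [List.drop_eq_getElem_cons hi, List.take_succ_eq_append_getElem hi,
        -List.getElem_cons_drop, -List.take_append_getElem]))
  simpa [rewind] using this

/-- The content of a cell, for a tape that is cut into the reversed list `l` and the list `r`. -/
def cell (l r : List G) (k : ℕ) : G := (l.reverse ++ r).getD k default

theorem cell_right (l r : List G) (k : ℕ) :
    cell (r.headD default :: l) r.tail k = cell l r k := by
  cases r with
  | nil =>
    simp only [cell, List.headD_nil, List.tail_nil, List.append_nil, List.reverse_cons]
    simp only [List.getD_eq_getElem?_getD, List.getElem?_append, List.getElem?_singleton]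
    split_ifs <;> simp_all
  | cons g r => simp [cell]

/-- `Advances N c d T`: the program `c` moves `d` cells to the right in at most `T` steps. -/
def Advances (N : ℕ) (c : Cmd (Stack.Alph (V := V) G) (Store Q G)) (d T : ℕ) : Prop :=
  ∀ a : Conf V Q G, a.dn none = 0 → a.rm none = N → ∃ l r, l.length = a.left.length + d ∧
    (∀ k, cell l r k = cell a.left a.right k) ∧ Sim c a { a with left := l, right := r } T

theorem advances_right (N : ℕ) : Advances N (right : Cmd (Stack.Alph (V := V) G) (Store Q G)) 1 2 :=
  fun a _ _ => ⟨_, _, rfl, cell_right _ _, sim_right a⟩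

/-- Move to the same column of the next row, which is `N + 1` cells away: the register `none` counts
from `0` to `N` and back. -/
def nextRow : Cmd (Stack.Alph (V := V) G) (Store Q G) :=
  .seq (whileNonempty (.rm none) (.seq (up none) right)) (.seq (clear none) right)

theorem advances_nextRow (N : ℕ) :
    Advances N (nextRow : Cmd (Stack.Alph (V := V) G) (Store Q G)) (N + 1) (10 * N + 6) := by
  intro a h0 hN
  have hdn : Function.update a.dn none 0 = a.dn := by simp [← h0]
  have hrm : Function.update a.rm none N = a.rm := by simp [← hN]
  obtain ⟨_, ⟨l, r, hl, hc, rfl⟩, hs⟩ := sim_whileNonempty (c := .seq (up none) right) (T := 4)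
    (.rm none) (a := a) (fun i b => ∃ l r, l.length = a.left.length + i ∧
      (∀ k, cell l r k = cell a.left a.right k) ∧
      b = { a with
        dn := Function.update a.dn none i
        rm := Function.update a.rm none (N - i)
        left := l
        right := r }) N
    (by rintro i hi _ ⟨l, r, -, -, rfl⟩; simp [Conf.stk]; omega)
    (by rintro _ ⟨l, r, -, -, rfl⟩; simp [Conf.stk])
    (by
      rintro i hi _ ⟨l, r, hl, hc, rfl⟩
      refine ⟨_, ⟨_, _, ?_, fun k => (cell_right l r k).trans (hc k), rfl⟩, ?_⟩
      · simp [hl, add_assoc]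
      · exact ((sim_up _ none).seq (sim_right _)).of_eq (by simp [Nat.sub_sub]))
    ⟨a.left, a.right, rfl, fun _ => rfl, by simp [hdn, hrm]⟩
  refine ⟨_, _, ?_, fun k => (cell_right l r k).trans (hc k), ?_⟩
  · simp [hl, add_assoc]
  · refine Sim.mono ?_ (T₁ := N * (4 + 2) + 2 + (N * 4 + 2 + 2)) (by omega)
    refine hs.seq ?_
    have h₂ := (sim_clear { a with
        dn := Function.update a.dn none N
        rm := Function.update a.rm none (N - N)
        left := l
        right := r } none).seq (sim_right _)
    simpa [hdn, hrm] using h₂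

/-- Run `c` as many times as the register `v` says. The tokens are moved to `tmp` and back. -/
def repeatReg (v : V) (c : Cmd (Stack.Alph (V := V) G) (Store Q G)) :
    Cmd (Stack.Alph (V := V) G) (Store Q G) :=
  .seq
    (whileNonempty (.dn v) (.seq (.pop (.dn v) fun s _ => s) (.seq (.push .tmp fun _ => ()) c)))
    (whileNonempty .tmp (.seq (.pop .tmp fun s _ => s) (.push (.dn v) fun _ => ())))

theorem sim_repeatReg {N d : ℕ} (h : Advances N c d T) (v : V) (a : Conf V Q G)
    (h0 : a.dn none = 0) (hN : a.rm none = N) (ht : a.tmp = 0) :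
    ∃ l r, l.length = a.left.length + a.dn v * d ∧
      (∀ k, cell l r k = cell a.left a.right k) ∧
      Sim (repeatReg v c) a { a with left := l, right := r } (a.dn v * (T + 8) + 4) := by
  obtain ⟨_, ⟨l, r, hl, hc, rfl⟩, hs⟩ := sim_whileNonempty
    (c := .seq (.pop (.dn v) fun s _ => s) (.seq (.push .tmp fun _ => ()) c)) (T := 1 + (1 + T))
    (.dn v) (a := a) (fun i b => ∃ l r, l.length = a.left.length + i * d ∧
      (∀ k, cell l r k = cell a.left a.right k) ∧
      b = { a with
        dn := Function.update a.dn v (a.dn v - i)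
        tmp := i
        left := l
        right := r }) (a.dn v)
    (by rintro i hi _ ⟨l, r, -, -, rfl⟩; simp [Conf.stk]; omega)
    (by rintro _ ⟨l, r, -, -, rfl⟩; simp [Conf.stk])
    (by
      rintro i hi _ ⟨l, r, hl, hc, rfl⟩
      obtain ⟨l', r', hl', hc', hs⟩ := h { a with
        dn := Function.update a.dn v (a.dn v - (i + 1))
        tmp := i + 1
        left := l
        right := r } (by simpa using h0) hN
      refine ⟨_, ⟨l', r', ?_, fun k => (hc' k).trans (hc k), rfl⟩, ?_⟩
      · simp only [hl', hl]; ring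
      · refine (sim_pop_dn _ _).seq ((sim_push_tmp _).seq ?_)
        simpa [Nat.sub_sub] using hs)
    ⟨a.left, a.right, by simp, fun _ => rfl, by
      obtain ⟨⟩ := a
      simp_all⟩
  refine ⟨l, r, hl, hc, ?_⟩
  refine Sim.mono (hs.seq (a₃ := { a with left := l, right := r })
    (T₂ := a.dn v * ((1 + 1) + 2) + 2) ?_) (by ring_nf; omega)
  have := sim_whileNonempty_of_fun
    (c := .seq (.pop .tmp fun s _ => s) (.push (.dn v) fun _ => ())) (T := 1 + 1) .tmp
    (fun i => { a with
      dn := Function.update a.dn v i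
      tmp := a.dn v - i
      left := l
      right := r }) (a.dn v)
    (fun i hi => by simp [Conf.stk]; omega) (by simp [Conf.stk])
    (fun i hi => ((sim_pop_tmp _).seq (sim_push_dn _ _)).of_eq (by simp [Nat.sub_sub]))
  obtain ⟨⟩ := a
  simp_all

/-- Cell `(x, y)` of the memory is kept at the address `x * (N + 1) + y` of the tape. -/
theorem address_inj {N x y x' y' : ℕ} (hy : y ≤ N) (hy' : y' ≤ N) :
    x * (N + 1) + y = x' * (N + 1) + y' ↔ x = x' ∧ y = y' := by
  have key : ∀ {x y}, y ≤ N → (x * (N + 1) + y) / (N + 1) = x := fun {x y} hy => by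
    rw [mul_comm, Nat.mul_add_div N.succ_pos, Nat.div_eq_of_lt (by omega), add_zero]
  refine ⟨fun h => ?_, fun h => by rw [h.1, h.2]⟩
  obtain rfl : x = x' := by rw [← key hy (x := x), h, key hy']
  exact ⟨rfl, by omega⟩

/-- Apply `f` to the control state and the cell under the head. -/
def visit (f : Q → G → Q × G) : Cmd (Stack.Alph (V := V) G) (Store Q G) :=
  .seq (.pop .right fun s o =>
    ((f s.1 (Option.getD o default)).1, (f s.1 (Option.getD o default)).2, s.2.2))
    (.push .right fun s => s.2.1)

theorem sim_visit (f : Q → G → Q × G) (a : Conf V Q G) :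
    Sim (visit f) a { a with
      q := (f a.q (a.right.headD default)).1
      right := (f a.q (a.right.headD default)).2 :: a.right.tail } 2 :=
  fun s => ⟨_, 2, le_rfl, by
    have h₁ := Runs.pop .right (fun (s : Store Q G) o =>
      ((f s.1 (Option.getD o default)).1, (f s.1 (Option.getD o default)).2, s.2.2))
      (a.q, s) a.stk
    rw [Conf.update_right] at h₁
    have h₂ := h₁.seq (Runs.push .right (fun (s : Store Q G) => s.2.1) _ _)
    rw [Conf.update_right] at h₂
    rw [List.headD_eq_head?_getD]
    exact h₂⟩

namespace Prog

/-- The stack program for a loop program. -/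
def compile : Prog V Q G → Cmd (Stack.Alph (V := V) G) (Store Q G)
  | load f => .load fun s => (f s.1, s.2)
  | read f => .pop .inp fun s o => (f s.1 o, s.2)
  | act i j f => .seq (.seq (repeatReg i nextRow) (repeatReg j right)) (.seq (visit f) rewind)
  | inc v => whenNonempty (.rm v) (up v)
  | clr v => clear v
  | seq a b => .seq a.compile b.compile
  | ite p a b => .ite (fun s => p s.1) a.compile b.compile
  | each v a =>
    .seq (clear v) (whileNonempty (.rm v) (.seq a.compile (whenNonempty (.rm v) (up v))))

end Prog

/-- The configuration `a` holds the data `e`, for an input of length `N`. -/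
structure Represents (N : ℕ) (e : Env V Q G) (a : Conf V Q G) : Prop where
  q : a.q = e.q
  inp : a.inp = e.inp
  sav : a.sav = []
  out : a.out = []
  tmp : a.tmp = 0
  left : a.left = []
  le : ∀ v, e.reg v ≤ N
  dn : ∀ v, a.dn v = v.elim 0 e.reg
  rm : ∀ v, a.rm v = N - v.elim 0 e.reg
  mem : ∀ i ≤ N, ∀ j ≤ N, a.right.getD (i * (N + 1) + j) default = e.mem i j

theorem Represents.sim_act {N : ℕ} {e : Env V Q G} {a : Conf V Q G} (h : Represents N e a)
    (i j : V) (f : Q → G → Q × G) :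
    ∃ a', Represents N ((Prog.act i j f).eval N e) a' ∧
      Sim (Prog.act i j f).compile a a' ((Prog.act i j f).time.eval N) := by
  obtain ⟨l₁, r₁, hl₁, hc₁, hs₁⟩ := sim_repeatReg (advances_nextRow N) i a
    (by simp [h.dn]) (by simp [h.rm]) h.tmp
  obtain ⟨l₂, r₂, hl₂, hc₂, hs₂⟩ := sim_repeatReg (advances_right N) j
    { a with left := l₁, right := r₁ } (by simp [h.dn]) (by simp [h.rm]) h.tmp
  simp only [h.left, h.dn, Option.elim_some, List.length_nil, zero_add, mul_one] at hl₁ hl₂ hs₁ hs₂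
  have hi := h.le i
  have hj := h.le j
  have hlen : l₂.length = e.reg i * (N + 1) + e.reg j := by rw [hl₂, hl₁]
  have hc : ∀ k, (l₂.reverse ++ r₂).getD k default = a.right.getD k default := fun k => by
    simpa [cell, h.left] using (hc₂ k).trans (hc₁ k)
  have hhead : r₂.headD default = e.mem (e.reg i) (e.reg j) := by
    rw [← h.mem _ hi _ hj, ← hc, List.getD_append_right _ _ _ _ (by simp [hlen])]
    cases r₂ <;> simp [hlen]
  refine ⟨_, ?_, ((hs₁.seq hs₂).seq ((sim_visit f _).seq (sim_rewind _))).mono ?_⟩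
  · refine ⟨by simp only [Prog.eval, hhead, h.q], h.inp, h.sav, h.out, h.tmp, rfl, h.le, h.dn,
      h.rm, fun x hx y hy => ?_⟩
    have h₁ : (l₂.reverse ++ (f a.q (r₂.headD default)).2 :: r₂.tail).getD (x * (N + 1) + y) default =
        if x * (N + 1) + y = l₂.length then (f a.q (r₂.headD default)).2
          else (l₂.reverse ++ r₂).getD (x * (N + 1) + y) default := by
      generalize x * (N + 1) + y = k
      split_ifs with hk
      · simp [hk]
      · simp only [List.getD_eq_getElem?_getD, List.getElem?_append, List.length_reverse]
        split_ifs with hk'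
        · rfl
        · obtain ⟨d, hd⟩ : ∃ d, k - l₂.length = d + 1 := ⟨k - l₂.length - 1, by omega⟩
          cases r₂ <;> simp [hd]
    refine h₁.trans ?_
    simp only [hc, h.mem x hx y hy, hlen, address_inj hy hj, hhead, h.q, Prog.eval,
      Function.update_apply]
    split_ifs <;> simp_all
  · have : e.reg i * (N + 1) ≤ N * (N + 1) := Nat.mul_le_mul_right _ hi
    have h' : e.reg i * (10 * N + 6 + 8) ≤ N * (10 * N + 6 + 8) := Nat.mul_le_mul_right _ hi
    simp only [Prog.time, hlen, eval_add, eval_mul, eval_pow, eval_X, eval_ofNat]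
    nlinarith

theorem Represents.sim_inc {N : ℕ} {e : Env V Q G} {a : Conf V Q G} (h : Represents N e a) (v : V) :
    ∃ a', Represents N ((Prog.inc v : Prog V Q G).eval N e) a' ∧
      Sim (Prog.inc v : Prog V Q G).compile a a' 4 := by
  have hv := h.le v
  rcases hv.eq_or_lt with hv | hv
  · refine ⟨a, ?_, (sim_whenNonempty_of_eq_nil (by simp [Conf.stk, h.rm, hv])).mono (by norm_num)⟩
    have : (Prog.inc v : Prog V Q G).eval N e = e := by
      have hmin : min (e.reg v + 1) N = e.reg v := by omega
      simp [Prog.eval, hmin]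
    rwa [this]
  · refine ⟨_, ?_, (sim_up a v).whenNonempty (by simp [Conf.stk, h.rm]; omega)⟩
    have hmin : min (e.reg v + 1) N = e.reg v + 1 := by omega
    refine ⟨h.q, h.inp, h.sav, h.out, h.tmp, h.left, fun u => ?_, fun u => ?_, fun u => ?_, h.mem⟩
    · rcases eq_or_ne u v with rfl | hu
      · simp [Prog.eval]
      · simpa [Prog.eval, hu] using h.le u
    · cases u with
      | none => simp [h.dn]
      | some u =>
        rcases eq_or_ne u v with rfl | hu
        · simp [Prog.eval, h.dn, hmin]
        · simp [Prog.eval, hu, h.dn]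
    · cases u with
      | none => simp [h.rm]
      | some u =>
        rcases eq_or_ne u v with rfl | hu
        · simp [Prog.eval, h.rm, hmin]; omega
        · simp [Prog.eval, hu, h.rm]

theorem Represents.sim_clr {N : ℕ} {e : Env V Q G} {a : Conf V Q G} (h : Represents N e a) (v : V) :
    ∃ a', Represents N ((Prog.clr v : Prog V Q G).eval N e) a' ∧
      Sim (Prog.clr v : Prog V Q G).compile a a' (4 * N + 2) := by
  have hv := h.le v
  refine ⟨_, ?_, (sim_clear a v).mono (by simp only [h.dn, Option.elim_some]; omega)⟩
  refine ⟨h.q, h.inp, h.sav, h.out, h.tmp, h.left, fun u => ?_, fun u => ?_, fun u => ?_, h.mem⟩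
  · rcases eq_or_ne u v with rfl | hu
    · simp [Prog.eval]
    · simpa [Prog.eval, hu] using h.le u
  · cases u with
    | none => simp [h.dn]
    | some u =>
      rcases eq_or_ne u v with rfl | hu
      · simp [Prog.eval]
      · simp [Prog.eval, hu, h.dn]
  · cases u with
    | none => simp [h.rm]
    | some u =>
      rcases eq_or_ne u v with rfl | hu
      · simp [Prog.eval, h.rm, h.dn]; omega
      · simp [Prog.eval, hu, h.rm]

/-- A well-formed loop program is simulated by its stack program. -/
theorem Represents.sim_compile {N : ℕ} {p : Prog V Q G} (hp : p.WellFormed) {e : Env V Q G}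
    {a : Conf V Q G} (h : Represents N e a) :
    ∃ a', Represents N (p.eval N e) a' ∧ Sim p.compile a a' (p.time.eval N) := by
  induction p generalizing e a with
  | load f =>
    refine ⟨_, ?_, (sim_load f a).mono (by simp [Prog.time])⟩
    exact ⟨by simp [Prog.eval, h.q], h.inp, h.sav, h.out, h.tmp, h.left, h.le, h.dn, h.rm, h.mem⟩
  | read f =>
    refine ⟨{ a with q := f a.q a.inp.head?, inp := a.inp.tail },
      ⟨by simp [Prog.eval, h.q, h.inp], by simp [Prog.eval, h.inp], h.sav, h.out, h.tmp, h.left,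
        h.le, h.dn, h.rm, h.mem⟩, fun s => ⟨s, 1, by simp [Prog.time], ?_⟩⟩
    have := Runs.pop .inp (fun (s : Store Q G) o => (f s.1 o, s.2)) (a.q, s) a.stk
    rw [Conf.update_inp] at this
    exact this
  | act i j f => exact h.sim_act i j f
  | inc v => simpa [Prog.time] using h.sim_inc v
  | clr v => simpa [Prog.time] using h.sim_clr v
  | seq p₁ p₂ ih₁ ih₂ =>
    obtain ⟨a₁, h₁, hs₁⟩ := ih₁ hp.1 h
    obtain ⟨a₂, h₂, hs₂⟩ := ih₂ hp.2 h₁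
    exact ⟨a₂, h₂, (hs₁.seq hs₂).mono (by simp [Prog.time])⟩
  | ite c p₁ p₂ ih₁ ih₂ =>
    rcases hc : c e.q with _ | _
    · obtain ⟨a₂, h₂, hs₂⟩ := ih₂ hp.2 h
      refine ⟨a₂, by simpa [Prog.eval, hc] using h₂, fun s => ?_⟩
      obtain ⟨s', t, ht, hr⟩ := hs₂ s
      exact ⟨s', _, by simp only [Prog.time, eval_add, eval_one]; omega,
        .ite_false (by simp [h.q, hc]) hr⟩
    · obtain ⟨a₂, h₂, hs₂⟩ := ih₁ hp.1 h
      refine ⟨a₂, by simpa [Prog.eval, hc] using h₂, fun s => ?_⟩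
      obtain ⟨s', t, ht, hr⟩ := hs₂ s
      exact ⟨s', _, by simp only [Prog.time, eval_add, eval_one]; omega,
        .ite_true (by simp [h.q, hc]) hr⟩
  | each v p ih =>
    obtain ⟨a₀, h₀, hs₀⟩ := h.sim_clr v
    set step : Env V Q G → Env V Q G := fun e => (Prog.inc v : Prog V Q G).eval N (p.eval N e)
      with hstep
    have hreg : ∀ i ≤ N, (step^[i] ((Prog.clr v : Prog V Q G).eval N e)).reg v = i := by
      intro i
      induction i with
      | zero => intro; simp [Prog.eval]
      | succ i ihi =>
        intro hi
        have hv : ∀ e, (step e).reg v = min ((p.eval N e).reg v + 1) N := fun e => by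
          simp [hstep, Prog.eval]
        rw [Function.iterate_succ_apply', hv, hp.1.reg_eval, ihi (by omega)]
        omega
    obtain ⟨a', h', hs'⟩ := sim_whileNonempty
      (c := .seq p.compile (Prog.inc v : Prog V Q G).compile) (T := p.time.eval N + 4)
      (.rm (some v)) (fun i b => Represents N (step^[i] ((Prog.clr v : Prog V Q G).eval N e)) b) N
      (fun i hi b hb => by
        simp only [Conf.stk, hb.rm, Option.elim_some, hreg i hi.le, ne_eq, List.replicate_eq_nil_iff]
        omega)
      (fun b hb => by simp [Conf.stk, hb.rm, hreg N le_rfl])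
      (fun i hi b hb => by
        obtain ⟨b₁, hb₁, hs₁⟩ := ih hp.2 hb
        obtain ⟨b₂, hb₂, hs₂⟩ := hb₁.sim_inc v
        refine ⟨b₂, ?_, hs₁.seq hs₂⟩
        rw [Function.iterate_succ_apply']
        exact hb₂) h₀
    refine ⟨a', h', (hs₀.seq hs').mono ?_⟩
    simp only [Prog.time, eval_add, eval_mul, eval_X, eval_ofNat]
    ring_nf
    omega

end Compile
end StackProgram

/-! ### Loop programs run in polynomial time -/

namespace StackProgram

open Cmd Polynomial

/-- A program that takes `t` steps makes no stack grow by more than `t`. -/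
theorem Cmd.Runs.length_le {K : Type} {Γ : K → Type} {σ : Type} [DecidableEq K] {c : Cmd Γ σ}
    {s s' : State Γ σ} {t : ℕ} (h : Runs c s s' t) (k : K) :
    (s'.2 k).length ≤ (s.2 k).length + t := by
  induction h with
  | push k' g v S =>
    rcases eq_or_ne k k' with rfl | hk
    · simp
    · simp [hk]
  | pop k' f v S =>
    rcases eq_or_ne k k' with rfl | hk
    · simp; omega
    · simp [hk]
  | peek | load | loop_done => simp
  | _ => omega

section

variable {V Q G : Type} [DecidableEq V]

/-- Empty the stack `k`. -/
def drain (k : Stack V) : Cmd (Stack.Alph (V := V) G) (Store Q G) :=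
  whileNonempty k (.pop k fun s _ => s)

theorem exists_runs_drain (k : Stack V) (S : ∀ k : Stack V, List (k.Alph G)) (q : Q)
    (s : G × Bool × Option Bool) :
    ∃ s', Runs (drain k) ((q, s), S) ((q, s'), Function.update S k []) ((S k).length * 3 + 2) := by
  have key : ∀ n (S : ∀ k : Stack V, List (k.Alph G)), (S k).length = n → ∀ (x : G) y, ∃ s',
      Runs (.loop (fun s => s.2.2.1) (.seq (.pop k fun s _ => s) (test k)))
        ((q, x, (S k).head?.isSome, y), S) ((q, s'), Function.update S k []) (n * 3 + 1) := by
    intro n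
    induction n with
    | zero =>
      intro S hS x y
      have hk := List.length_eq_zero_iff.1 hS
      have : Function.update S k [] = S := by rw [← hk, Function.update_eq_self]
      rw [this]
      exact ⟨_, .loop_done (by simp [hk])⟩
    | succ n ih =>
      intro S hS x y
      obtain ⟨s', hr⟩ := ih (Function.update S k (S k).tail) (by simp [hS]) x y
      rw [Function.update_idem] at hr
      refine ⟨s', ?_⟩
      rw [show (n + 1) * 3 + 1 = (1 + 1) + (n * 3 + 1) + 1 by ring]
      refine .loop_step ?_ (.seq (.pop _ _ _ _) (.peek _ _ _ _)) hr
      obtain ⟨g, l, hl⟩ := List.exists_cons_of_length_eq_add_one hS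
      simp [hl]
  obtain ⟨s', hr⟩ := key _ S rfl s.1 s.2.2
  refine ⟨s', ?_⟩
  rw [show (S k).length * 3 + 2 = 1 + ((S k).length * 3 + 1) by ring]
  exact .seq (.peek _ _ _ _) hr

/-- Empty all stacks in a list. -/
def drainAll : List (Stack V) → Cmd (Stack.Alph (V := V) G) (Store Q G)
  | [] => .load id
  | k :: l => .seq (drain k) (drainAll l)

theorem exists_runs_drainAll (l : List (Stack V)) (S : ∀ k : Stack V, List (k.Alph G)) (q : Q)
    (s : G × Bool × Option Bool) (B : ℕ) (hB : ∀ k, (S k).length ≤ B) :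
    ∃ s' t, t ≤ l.length * (B * 3 + 2) + 1 ∧
      Runs (drainAll l) ((q, s), S) ((q, s'), fun k => if k ∈ l then [] else S k) t := by
  induction l generalizing S s with
  | nil => exact ⟨s, 1, by simp, by simpa using .load _ _ _⟩
  | cons k l ih =>
    obtain ⟨s₁, h₁⟩ := exists_runs_drain k S q s
    obtain ⟨s₂, t, ht, h₂⟩ := ih (Function.update S k []) s₁ fun k' => by
      rcases eq_or_ne k' k with rfl | hk
      · simp
      · simpa [hk] using hB k'
    refine ⟨s₂, (S k).length * 3 + 2 + t, ?_, ?_⟩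
    · have := hB k
      rw [List.length_cons, add_mul]
      omega
    · rw [drainAll]
      convert h₁.seq h₂ using 3 with k'
      rcases eq_or_ne k' k with rfl | hk
      · simp
      · simp [hk]

/-- Put a token on each stack `rm v` with `v` in a list. -/
def pushAll : List (Option V) → Cmd (Stack.Alph (V := V) G) (Store Q G)
  | [] => .load fun s => (s.1, s.2)
  | v :: l => .seq (.push (.rm v) fun _ => ()) (pushAll l)

theorem sim_pushAll (l : List (Option V)) (a : Conf V Q G) :
    Sim (pushAll l) a { a with rm := fun v => a.rm v + l.count v } (l.length + 1) := by
  induction l generalizing a with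
  | nil => simpa [pushAll] using sim_load id a
  | cons v l ih =>
    refine (((sim_push_rm a v).seq (ih _)).of_eq ?_).mono (by simp; omega)
    congr 1
    funext u
    rcases eq_or_ne u v with rfl | hu
    · simp; ring
    · simp [hu, List.count_cons_of_ne hu.symm]

theorem sim_inp_sav (a : Conf V Q G) (o : Option Bool) (l : List (Option Bool))
    (h : a.inp = o :: l) :
    Sim (.seq (.pop .inp fun s o => (s.1, s.2.1, s.2.2.1, Option.getD o none))
      (.push .sav fun s => s.2.2.2)) a { a with inp := l, sav := o :: a.sav } 2 :=
  fun s => ⟨_, 2, le_rfl, by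
    have h₁ := Runs.pop .inp
      (fun (s : Store Q G) (o : Option (Option Bool)) => (s.1, s.2.1, s.2.2.1, Option.getD o none))
      (a.q, s) a.stk
    rw [Conf.update_inp] at h₁
    have h₂ := h₁.seq (Runs.push .sav (fun (s : Store Q G) => s.2.2.2) _ _)
    rw [Conf.update_sav] at h₂
    simpa [Conf.stk, h] using h₂⟩

theorem sim_sav_inp (a : Conf V Q G) (o : Option Bool) (l : List (Option Bool))
    (h : a.sav = o :: l) :
    Sim (.seq (.pop .sav fun s o => (s.1, s.2.1, s.2.2.1, Option.getD o none))
      (.push .inp fun s => s.2.2.2)) a { a with sav := l, inp := o :: a.inp } 2 :=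
  fun s => ⟨_, 2, le_rfl, by
    have h₁ := Runs.pop .sav
      (fun (s : Store Q G) (o : Option (Option Bool)) => (s.1, s.2.1, s.2.2.1, Option.getD o none))
      (a.q, s) a.stk
    rw [Conf.update_sav] at h₁
    have h₂ := h₁.seq (Runs.push .inp (fun (s : Store Q G) => s.2.2.2) _ _)
    rw [Conf.update_inp] at h₂
    simpa [Conf.stk, h] using h₂⟩

variable [Fintype V]

/-- Initialize the registers to `0`, for an upper bound given by the length of the input. -/
noncomputable def setup : Cmd (Stack.Alph (V := V) G) (Store Q G) :=
  .seq
    (whileNonempty .inp (.seq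
      (.seq (.pop .inp fun s o => (s.1, s.2.1, s.2.2.1, Option.getD o none))
        (.push .sav fun s => s.2.2.2))
      (pushAll Finset.univ.toList)))
    (whileNonempty .sav (.seq (.pop .sav fun s o => (s.1, s.2.1, s.2.2.1, Option.getD o none))
      (.push .inp fun s => s.2.2.2)))

theorem sim_setup (q : Q) (w : List (Option Bool)) :
    Sim (setup : Cmd (Stack.Alph (V := V) G) (Store Q G))
      ⟨q, w, [], [], fun _ => 0, fun _ => 0, 0, [], []⟩
      ⟨q, w, [], [], fun _ => 0, fun _ => w.length, 0, [], []⟩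
      (w.length * (Fintype.card V + 10) + 4) := by
  have h₁ := sim_whileNonempty_of_fun (c := (.seq
      (.seq (.pop .inp fun s o => (s.1, s.2.1, s.2.2.1, Option.getD o none))
        (.push .sav fun s => s.2.2.2))
      (pushAll Finset.univ.toList))) (T := 2 + (Fintype.card V + 2)) (.inp : Stack V)
    (fun i => (⟨q, w.drop i, (w.take i).reverse, [], fun _ => 0, fun _ => i, 0, [], []⟩ :
      Conf V Q G)) w.length
    (fun i hi => by simp [Conf.stk]; omega) (by simp [Conf.stk])
    (fun i hi => by
      refine (((sim_inp_sav _ w[i] (w.drop (i + 1)) (by simp)).seq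
        (sim_pushAll _ _)).of_eq ?_).mono ?_
      · simp [List.take_succ_eq_append_getElem hi, -List.take_append_getElem,
          List.count_eq_one_of_mem (Finset.nodup_toList _) (Finset.mem_toList.2 (Finset.mem_univ _))]
      · simp)
  have h₂ := sim_whileNonempty_of_fun
    (c := (.seq (.pop .sav fun s o => (s.1, s.2.1, s.2.2.1, Option.getD o none))
      (.push .inp fun s => s.2.2.2))) (T := 2) (.sav : Stack V)
    (fun i => (⟨q, w.drop (w.length - i), (w.take (w.length - i)).reverse, [], fun _ => 0,
      fun _ => w.length, 0, [], []⟩ : Conf V Q G)) w.length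
    (fun i hi => by
      have : w ≠ [] := by rintro rfl; simp at hi
      simp [Conf.stk, this]; omega) (by simp [Conf.stk])
    (fun i hi => by
      have h₀ : w.length - i = w.length - (i + 1) + 1 := by omega
      rw [h₀]
      refine (sim_sav_inp _ (w[w.length - (i + 1)]) ((w.take (w.length - (i + 1))).reverse) ?_).of_eq ?_
      · simp [List.take_succ_eq_append_getElem (show w.length - (i + 1) < w.length by omega),
          -List.take_append_getElem]
      · simp)
  simp only [List.drop_zero, List.take_zero, List.reverse_nil, List.drop_length, List.take_length,
    Nat.sub_zero, Nat.sub_self] at h₁ h₂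
  exact (h₁.seq h₂).mono (by ring_nf; omega)

variable [Inhabited G] [Fintype Q] [Fintype G]

/-- A Boolean function of words that is decided by a loop program is computable in polynomial
time. -/
theorem Prog.nonempty_tm2ComputableInPolyTime {α : Type} (p : Prog V Q G) (hp : p.WellFormed)
    (q₀ : Q) (ans : Q → Bool) (enc : α → List (Option Bool)) (f : α → Bool)
    (h : ∀ x, ans (p.eval (enc x).length ⟨q₀, fun _ => 0, fun _ _ => default, enc x⟩).q = f x) :
    Nonempty (Turing.TM2ComputableInPolyTime enc Computability.encodeBool f) := by
  classical
  let s₀ : Store Q G := (q₀, default, false, none)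
  let c : Cmd (Stack.Alph (V := V) G) (Store Q G) :=
    .seq (.seq setup p.compile)
      (.seq (drainAll Finset.univ.toList) (.seq (.push .out fun s => ans s.1) (.load fun _ => s₀)))
  let T : Polynomial ℕ := X * ((Fintype.card V : Polynomial ℕ) + 10) + 4 + p.time
  let P : Polynomial ℕ :=
    T + ((Fintype.card (Stack V) : Polynomial ℕ) * ((X + T) * 3 + 2) + 1 + 2) + 1
  have key : ∀ x, ∃ t ≤ P.eval (enc x).length,
      (flip bind (machine c .inp .out s₀).step)^[t]
        (some ⟨some (some c.entry), s₀,
          (⟨q₀, enc x, [], [], fun _ => 0, fun _ => 0, 0, [], []⟩ : Conf V Q G).stk⟩) =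
        some ⟨none, s₀, (⟨q₀, [], [], [f x], fun _ => 0, fun _ => 0, 0, [], []⟩ : Conf V Q G).stk⟩ := by
    intro x
    -- run the program, empty all stacks, write the answer and reset the local store
    obtain ⟨a, ha, hs⟩ := Represents.sim_compile (N := (enc x).length) hp
      (e := ⟨q₀, fun _ => 0, fun _ _ => default, enc x⟩)
      (a := (⟨q₀, enc x, [], [], fun _ => 0, fun _ => (enc x).length, 0, [], []⟩ : Conf V Q G))
      ⟨rfl, rfl, rfl, rfl, rfl, rfl, by simp, by rintro (_ | _) <;> simp, by rintro (_ | _) <;> simp,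
        by simp⟩
    obtain ⟨s₁, t₁, ht₁, hr₁⟩ := ((sim_setup q₀ (enc x)).seq hs) s₀.2
    replace ht₁ : t₁ ≤ T.eval (enc x).length := by
      simpa [T] using ht₁
    obtain ⟨s₂, t₂, ht₂, hr₂⟩ := exists_runs_drainAll Finset.univ.toList a.stk a.q s₁
      ((enc x).length + T.eval (enc x).length) fun k => by
        refine (hr₁.length_le k).trans (add_le_add ?_ ht₁)
        cases k <;> simp [Conf.stk]
    have hr₃ := hr₂.seq ((Runs.push .out (fun (s : Store Q G) => ans s.1) _ _).seq
      (Runs.load (fun _ => s₀) _ _))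
    have hr := (hr₁.seq hr₃).iterate_machine .inp .out s₀
    refine ⟨_, ?_, hr.trans ?_⟩
    · simp only [P, eval_add, eval_mul, eval_natCast, Nat.cast_id, eval_X, eval_ofNat, eval_one]
      simp only [Finset.length_toList, Finset.card_univ] at ht₂
      omega
    · simp only [← h x, ← ha.q, Finset.mem_toList, Finset.mem_univ, if_true]
      congr 2
      funext k
      cases k <;> rfl
  choose t ht hrun using key
  exact ⟨{
    tm := machine c .inp .out s₀
    inputAlphabet := Equiv.refl _
    outputAlphabet := Equiv.refl _
    time := P
    outputsFun := fun x => {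
      steps := t x
      evals_in_steps := by
        refine Eq.trans (congrArg _ (congrArg some ?_)) ((hrun x).trans (congrArg some ?_))
        · refine congrArg (fun S => (⟨some (some c.entry), s₀, S⟩ : Turing.TM2.Cfg _ _ _)) ?_
          funext k
          cases k <;> simp [machine, Conf.stk]
          rfl
        · refine congrArg (fun S => (⟨none, s₀, S⟩ : Turing.TM2.Cfg _ _ _)) ?_
          funext k
          cases k <;> rfl
      steps_le_m := ht x } }⟩

end

end StackProgram

/-! ### Degree-constrained subgraphs by pushing and relabelling -/

namespace DegreeFlow

open Finset

/-- The number of pairs in `H` with first entry `x`. -/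
def row (H : Finset (ℕ × ℕ)) (x : ℕ) : ℕ := #{p ∈ H | p.1 = x}

/-- The number of pairs in `H` with second entry `y`. -/
def col (H : Finset (ℕ × ℕ)) (y : ℕ) : ℕ := #{p ∈ H | p.2 = y}

/-- `F` is a set of edges of the bipartite graph `A` with degree `b x` at each left vertex `x`, and
degree at most `2` at each right vertex. -/
structure IsSolution (A : Finset (ℕ × ℕ)) (b : ℕ → ℕ) (F : Finset (ℕ × ℕ)) : Prop where
  subset : F ⊆ A
  row_eq : ∀ x, row F x = b x
  col_le : ∀ y, col F y ≤ 2

/-- A set of chosen edges together with levels of the left vertices. -/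
structure Stage where
  H : Finset (ℕ × ℕ)
  lev : ℕ → ℕ

variable {A : Finset (ℕ × ℕ)} {b : ℕ → ℕ} {H : Finset (ℕ × ℕ)} {s s' : Stage} {m x y z i : ℕ}

theorem row_insert (h : (x, y) ∉ H) (z : ℕ) :
    row (insert (x, y) H) z = row H z + if x = z then 1 else 0 := by
  unfold row
  rw [filter_insert]
  split_ifs
  · rw [card_insert_of_notMem (by simp [h])]
  · simp

theorem col_insert (h : (x, y) ∉ H) (z : ℕ) :
    col (insert (x, y) H) z = col H z + if y = z then 1 else 0 := by
  unfold col
  rw [filter_insert]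
  split_ifs
  · rw [card_insert_of_notMem (by simp [h])]
  · simp

theorem row_erase (h : (x, y) ∈ H) (z : ℕ) :
    row (H.erase (x, y)) z + (if x = z then 1 else 0) = row H z := by
  conv_rhs => rw [← insert_erase h]
  rw [row_insert (by simp)]

theorem col_erase (h : (x, y) ∈ H) (z : ℕ) :
    col (H.erase (x, y)) z + (if y = z then 1 else 0) = col H z := by
  conv_rhs => rw [← insert_erase h]
  rw [col_insert (by simp)]

/-- The moves of the algorithm. A left vertex `x` that has not enough edges takes a free place at a
neighbour, or takes the place of a left vertex of smaller level; if neither is possible, it may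
increase its level. -/
inductive Step (A : Finset (ℕ × ℕ)) (b : ℕ → ℕ) : Stage → Stage → Prop
  | add {H lev x y} : (x, y) ∈ A → (x, y) ∉ H → row H x < b x → col H y < 2 →
      Step A b ⟨H, lev⟩ ⟨insert (x, y) H, lev⟩
  | swap {H lev x y z} : (x, y) ∈ A → (x, y) ∉ H → row H x < b x → (z, y) ∈ H → lev z < lev x →
      Step A b ⟨H, lev⟩ ⟨insert (x, y) (H.erase (z, y)), lev⟩
  | raise {H lev x} : row H x < b x →
      (∀ y, (x, y) ∈ A → (x, y) ∉ H → col H y = 2 ∧ ∀ z, (z, y) ∈ H → lev x ≤ lev z) →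
      Step A b ⟨H, lev⟩ ⟨H, Function.update lev x (lev x + 1)⟩

/-- The invariant of the algorithm. The last condition says that a vertex of positive level with an
unused edge `xy` sees a full `y` whose users have at least the level of `x`, minus one. -/
structure Inv (A : Finset (ℕ × ℕ)) (b : ℕ → ℕ) (s : Stage) : Prop where
  subset : s.H ⊆ A
  row_le : ∀ x, row s.H x ≤ b x
  col_le : ∀ y, col s.H y ≤ 2
  valid : ∀ x y, (x, y) ∈ A → (x, y) ∉ s.H →
    s.lev x = 0 ∨ (col s.H y = 2 ∧ ∀ z, (z, y) ∈ s.H → s.lev x ≤ s.lev z + 1)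

theorem inv_empty (A : Finset (ℕ × ℕ)) (b : ℕ → ℕ) : Inv A b ⟨∅, fun _ => 0⟩ :=
  ⟨by simp, by simp [row], by simp [col], by simp⟩

theorem Inv.step (hs : Inv A b s) (h : Step A b s s') : Inv A b s' := by
  cases h with
  | @add H lev x y hA hH hr hc =>
    refine ⟨insert_subset hA hs.subset, fun x' => ?_, fun y' => ?_, fun x' y' hA' hH' => ?_⟩
    · have := hs.row_le x'
      rw [row_insert hH]
      split_ifs with h
      · subst h; exact hr
      · simpa using this
    · have := hs.col_le y'
      rw [col_insert hH]
      split_ifs with h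
      · subst h; exact hc
      · simpa using this
    · have hv := hs.valid x' y' hA' fun h => hH' (mem_insert_of_mem h)
      refine hv.imp_right fun ⟨h₂, hz⟩ => ?_
      have hy : y ≠ y' := by
        rintro rfl
        exact absurd h₂ hc.ne
      rw [col_insert hH, if_neg hy]
      refine ⟨h₂, fun z h => hz z ?_⟩
      simpa [hy.symm] using h
  | @swap H lev x y z hA hH hr hz hl =>
    have hxz : x ≠ z := by rintro rfl; exact hH hz
    have hH' : (x, y) ∉ H.erase (z, y) := fun h => hH (mem_of_mem_erase h)
    have hcol : ∀ y', col (insert (x, y) (H.erase (z, y))) y' = col H y' := fun y' => by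
      rw [col_insert hH', col_erase hz]
    have hx := (hs.valid x y hA hH).resolve_left (by simp only; omega)
    refine ⟨insert_subset hA ((erase_subset _ _).trans hs.subset), fun x' => ?_, fun y' => ?_,
      fun x' y' hA' hn => ?_⟩
    · have h₁ := hs.row_le x'
      have h₂ := row_erase hz x'
      rw [row_insert hH']
      split_ifs with h
      · subst h
        simp only [hxz.symm, if_false] at h₂
        simp only at h₁
        omega
      · simp only at h₁
        omega
    · rw [hcol]; exact hs.col_le y'
    · rw [hcol]
      by_cases hm : (x', y') ∈ H
      · obtain ⟨rfl, rfl⟩ : x' = z ∧ y' = y := by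
          by_contra hne
          exact hn (mem_insert_of_mem (mem_erase.2 ⟨by simpa using hne, hm⟩))
        refine Or.inr ⟨hx.1, fun w hw => ?_⟩
        rcases mem_insert.1 hw with h | h
        · obtain rfl : w = x := by simpa using h
          simp only at hl ⊢; omega
        · have := hx.2 w (mem_of_mem_erase h)
          simp only at this ⊢; omega
      · refine (hs.valid x' y' hA' hm).imp_right fun ⟨h₂, hw⟩ => ⟨h₂, fun w h => ?_⟩
        rcases mem_insert.1 h with h | h
        · obtain ⟨rfl, rfl⟩ : w = x ∧ y' = y := by simpa using h
          have := hw z hz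
          simp only at this ⊢; omega
        · exact hw w (mem_of_mem_erase h)
  | @raise H lev x hr hx =>
    refine ⟨hs.subset, hs.row_le, hs.col_le, fun x' y' hA' hn => ?_⟩
    rcases eq_or_ne x' x with rfl | hne
    · obtain ⟨h₂, hz⟩ := hx y' hA' hn
      refine Or.inr ⟨h₂, fun z h => ?_⟩
      have := hz z h
      rcases eq_or_ne z x' with rfl | h
      · simp
      · simp [h, this]
    · refine (hs.valid x' y' hA' hn).imp (fun h => by simpa [hne] using h) fun ⟨h₂, hz⟩ =>
        ⟨h₂, fun z h => ?_⟩
      have := hz z h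
      simp only [Function.update_apply, hne, if_false] at this ⊢
      split_ifs with h
      · subst h; omega
      · exact this

theorem card_filter_fst_mem (H : Finset (ℕ × ℕ)) (S : Finset ℕ) :
    #{p ∈ H | p.1 ∈ S} = ∑ x ∈ S, row H x := by
  rw [card_eq_sum_card_fiberwise (f := Prod.fst) (t := S) (by intro; simp)]
  refine sum_congr rfl fun x hx => ?_
  rw [row, filter_filter]
  congr 1
  ext p
  simp only [mem_filter]
  constructor
  · rintro ⟨h, -, rfl⟩; exact ⟨h, rfl⟩
  · rintro ⟨h, rfl⟩; exact ⟨h, hx, rfl⟩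

/-- If there is a solution, then a vertex without enough edges has level less than the number of
left vertices. Otherwise some level `k` below is not attained, and counting the edges at the set `S`
of vertices above that level shows that `S` has too few places at its neighbours. -/
theorem Inv.lev_lt (hs : Inv A b s) (hb : ∀ x, m ≤ x → b x = 0) {F : Finset (ℕ × ℕ)}
    (hF : IsSolution A b F) (hx : row s.H x < b x) : s.lev x < m := by
  classical
  by_contra! hlev
  have hxm : x < m := by
    by_contra! h
    rw [hb x h] at hx
    omega
  obtain ⟨k, hk, hgap⟩ : ∃ k ∈ range m, k ∉ ((range m).erase x).image s.lev := by
    by_contra! h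
    have h₁ := card_le_card (show range m ⊆ _ from h)
    have h₂ := card_image_le (s := (range m).erase x) (f := s.lev)
    rw [card_erase_of_mem (mem_range.2 hxm)] at h₂
    simp only [card_range] at h₁ h₂
    omega
  replace hk := mem_range.1 hk
  replace hgap : ∀ z < m, s.lev z ≠ k := by
    intro z hz h
    rcases eq_or_ne z x with rfl | hzx
    · omega
    · exact hgap (mem_image.2 ⟨z, mem_erase.2 ⟨hzx, mem_range.2 hz⟩, h⟩)
  set S : Finset ℕ := {z ∈ range m | k < s.lev z} with hS
  have hxS : x ∈ S := by simp [hS, hxm]; omega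
  let P : ℕ → Prop := fun y => col s.H y = 2 ∧ ∀ z, (z, y) ∈ s.H → z ∈ S
  have hmem : ∀ {z y}, (z, y) ∈ s.H → z < m := fun {z y} h => by
    by_contra! hz
    have h₁ := hs.row_le z
    have h₂ : 0 < row s.H z := card_pos.2 ⟨(z, y), by simp [h]⟩
    rw [hb z hz] at h₁
    omega
  -- an unused edge at `S` leads to a full vertex that is used by `S` only
  have hkey : ∀ p ∈ F, p.1 ∈ S → ¬ P p.2 → p ∈ s.H := by
    rintro ⟨u, y⟩ hp hu hy
    by_contra hn
    have hku : k < s.lev u := (mem_filter.1 hu).2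
    obtain ⟨h₂, hz⟩ := (hs.valid u y (hF.subset hp) hn).resolve_left (by omega)
    refine hy ⟨h₂, fun z h => ?_⟩
    have h₃ := hz z h
    have h₄ := hgap z (hmem h)
    simp [hS, hmem h]
    omega
  have h₁ : #{p ∈ {p ∈ F | p.1 ∈ S} | ¬ P p.2} ≤ #{p ∈ {p ∈ s.H | p.1 ∈ S} | ¬ P p.2} := by
    refine card_le_card fun p hp => ?_
    simp only [mem_filter] at hp ⊢
    exact ⟨⟨hkey p hp.1.1 hp.1.2 hp.2, hp.1.2⟩, hp.2⟩
  have h₂ : #{p ∈ {p ∈ F | p.1 ∈ S} | P p.2} ≤ #{p ∈ {p ∈ s.H | p.1 ∈ S} | P p.2} := by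
    set Y := (F ∪ s.H).image Prod.snd with hY
    rw [card_eq_sum_card_fiberwise (f := Prod.snd) (t := Y), card_eq_sum_card_fiberwise
      (f := Prod.snd) (t := Y)]
    · refine sum_le_sum fun y _ => ?_
      by_cases hy : P y
      · calc _ ≤ col F y := card_le_card fun p hp => by
              simp only [mem_filter] at hp ⊢; exact ⟨hp.1.1.1, hp.2⟩
          _ ≤ col s.H y := (hF.col_le y).trans hy.1.ge
          _ ≤ _ := card_le_card fun p hp => by
              simp only [mem_filter] at hp ⊢
              obtain ⟨hp, rfl⟩ := hp
              exact ⟨⟨⟨hp, hy.2 _ hp⟩, hy⟩, rfl⟩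
      · rw [card_eq_zero.2]
        · simp
        · refine filter_eq_empty_iff.2 fun p hp => ?_
          rintro rfl
          exact hy (mem_filter.1 hp).2
    · intro p hp
      simp only [coe_filter, Set.mem_ofPred_eq, mem_filter] at hp
      exact mem_coe.2 (mem_image_of_mem _ (mem_union_right _ hp.1.1))
    · intro p hp
      simp only [coe_filter, Set.mem_ofPred_eq, mem_filter] at hp
      exact mem_coe.2 (mem_image_of_mem _ (mem_union_left _ hp.1.1))
  have h₃ : ∑ z ∈ S, row s.H z < ∑ z ∈ S, b z := sum_lt_sum (fun z _ => hs.row_le z) ⟨x, hxS, hx⟩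
  have h₄ : ∑ z ∈ S, b z = #{p ∈ F | p.1 ∈ S} := by
    rw [card_filter_fst_mem]
    exact sum_congr rfl fun z _ => (hF.row_eq z).symm
  rw [h₄, ← card_filter_fst_mem,
    ← card_filter_add_card_filter_not (s := {p ∈ F | p.1 ∈ S}) fun p => P p.2,
    ← card_filter_add_card_filter_not (s := {p ∈ s.H | p.1 ∈ S}) fun p => P p.2] at h₃
  omega

/-- A measure of the progress of the algorithm, for `m` left vertices. -/
def potential (m : ℕ) (s : Stage) : ℕ := ∑ x ∈ range m, s.lev x + ∑ p ∈ s.H, (s.lev p.1 + 1)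

theorem Step.potential_lt (hb : ∀ x, m ≤ x → b x = 0) (h : Step A b s s') :
    potential m s < potential m s' := by
  cases h with
  | add hA hH hr hc =>
    simp only [potential, sum_insert hH]
    omega
  | @swap H lev x y z hA hH hr hz hl =>
    have hH' : (x, y) ∉ H.erase (z, y) := fun h => hH (mem_of_mem_erase h)
    have := add_sum_erase H (fun p => lev p.1 + 1) hz
    simp only [potential, sum_insert hH'] at this ⊢
    omega
  | @raise H lev x hr hx =>
    have hxm : x ∈ range m := by
      by_contra h
      rw [hb x (by simpa using h)] at hr
      omega
    have hle : ∀ z, lev z ≤ Function.update lev x (lev x + 1) z := fun z => by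
      rcases eq_or_ne z x with rfl | h
      · simp
      · simp [h]
    refine add_lt_add_of_lt_of_le (sum_lt_sum (fun z _ => hle z) ⟨x, hxm, by simp⟩)
      (sum_le_sum fun p _ => ?_)
    have := hle p.1
    simp only at this ⊢
    omega

theorem Inv.lev_le_step (hs : Inv A b s) (hb : ∀ x, m ≤ x → b x = 0) {F : Finset (ℕ × ℕ)}
    (hF : IsSolution A b F) (hlev : ∀ x, s.lev x ≤ m) (h : Step A b s s') (x : ℕ) :
    s'.lev x ≤ m := by
  cases h with
  | add | swap => exact hlev x
  | @raise H lev u hr hx =>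
    have := hs.lev_lt hb hF hr
    have := hlev x
    simp only [Function.update_apply] at *
    split_ifs <;> omega

theorem Inv.potential_le (hs : Inv A b s) (hb : ∀ x, m ≤ x → b x = 0) (hb₂ : ∀ x, b x ≤ 2)
    (hlev : ∀ x, s.lev x ≤ m) : potential m s ≤ m * m + m * 2 * (m + 1) := by
  have hH : #s.H ≤ m * 2 := by
    have : #s.H = #{p ∈ s.H | p.1 ∈ range m} := by
      congr 1
      refine (filter_true_of_mem fun p hp => ?_).symm
      by_contra h
      have h₁ := hs.row_le p.1
      have h₂ : 0 < row s.H p.1 := card_pos.2 ⟨p, by simp [hp]⟩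
      rw [hb _ (by simpa using h)] at h₁
      omega
    rw [this, card_filter_fst_mem]
    refine (sum_le_card_nsmul _ _ 2 fun x _ => (hs.row_le x).trans (hb₂ x)).trans ?_
    simp
  refine add_le_add ?_ ?_
  · simpa using sum_le_card_nsmul (range m) s.lev m fun x _ => hlev x
  · refine (sum_le_card_nsmul s.H _ (m + 1) fun p _ => by simpa using hlev p.1).trans ?_
    simpa using Nat.mul_le_mul_right (m + 1) hH

/-- What is known about the stages that the algorithm reaches. -/
structure Reached (A : Finset (ℕ × ℕ)) (b : ℕ → ℕ) (m : ℕ) (s : Stage) : Prop where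
  inv : Inv A b s
  lev_le : (∃ F, IsSolution A b F) → ∀ x, s.lev x ≤ m

theorem reached_empty (A : Finset (ℕ × ℕ)) (b : ℕ → ℕ) (m : ℕ) :
    Reached A b m ⟨∅, fun _ => 0⟩ := ⟨inv_empty A b, fun _ _ => Nat.zero_le _⟩

theorem Reached.steps (hs : Reached A b m s) (hb : ∀ x, m ≤ x → b x = 0)
    (h : Relation.ReflTransGen (Step A b) s s') : Reached A b m s' := by
  induction h with
  | refl => exact hs
  | tail _ h ih =>
    exact ⟨ih.inv.step h, fun ⟨F, hF⟩ => ih.inv.lev_le_step hb hF (ih.lev_le ⟨F, hF⟩) h⟩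

/-- All left vertices have enough edges. -/
def Satisfied (b : ℕ → ℕ) (s : Stage) : Prop := ∀ x, b x ≤ row s.H x

theorem Satisfied.not_step (hs : Satisfied b s) : ¬ Step A b s s' := by
  rintro (⟨-, -, h, -⟩ | ⟨-, -, h, -, -⟩ | ⟨h, -⟩) <;> exact absurd (hs _) h.not_ge

theorem Reached.isSolution (hs : Reached A b m s) (h : Satisfied b s) : IsSolution A b s.H :=
  ⟨hs.inv.subset, fun x => le_antisymm (hs.inv.row_le x) (h x), hs.inv.col_le⟩

theorem potential_mono (hb : ∀ x, m ≤ x → b x = 0) (h : Relation.ReflTransGen (Step A b) s s') :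
    potential m s ≤ potential m s' := by
  induction h with
  | refl => exact le_rfl
  | tail _ h ih => exact ih.trans (h.potential_lt hb).le

/-- A round in which some step is made, unless all vertices have enough edges, makes progress. -/
theorem Reached.progress (hs : Reached A b m s) (hb : ∀ x, m ≤ x → b x = 0)
    (hsol : ∃ F, IsSolution A b F) (h : Relation.ReflTransGen (Step A b) s s')
    (h' : ∀ x, row s.H x < b x → s.lev x < m → Relation.TransGen (Step A b) s s')
    (hi : Satisfied b s ∨ i ≤ potential m s) : Satisfied b s' ∨ i + 1 ≤ potential m s' := by
  by_cases hsat : Satisfied b s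
  · rcases Relation.ReflTransGen.cases_head h with rfl | ⟨_, h, -⟩
    · exact Or.inl hsat
    · exact absurd h hsat.not_step
  · obtain ⟨x, hx⟩ := not_forall.1 hsat
    obtain ⟨F, hF⟩ := hsol
    obtain ⟨u, hu, hus⟩ := Relation.TransGen.head'_iff.1
      (h' x (not_le.1 hx) (hs.inv.lev_lt hb hF (not_le.1 hx)))
    have h₁ := hu.potential_lt hb
    have h₂ := potential_mono hb hus
    have h₃ := hi.resolve_left hsat
    exact Or.inr (by omega)

/-- After more than `3 * m ^ 2 + 2 * m` rounds the algorithm has found a solution if there is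
one. -/
theorem Reached.satisfied (hs : Reached A b m s) (hb : ∀ x, m ≤ x → b x = 0) (hb₂ : ∀ x, b x ≤ 2)
    (hsol : ∃ F, IsSolution A b F) (hi : Satisfied b s ∨ i ≤ potential m s)
    (him : m * m + m * 2 * (m + 1) < i) : Satisfied b s := by
  refine hi.resolve_right fun h => ?_
  have := hs.inv.potential_le hb hb₂ (hs.lev_le hsol)
  omega

end DegreeFlow

/-! ### `S`-pairs and factors -/

/-- A nonnegative integer matrix whose rows and columns all have the sum `d > 0` has a permutation
in its support. -/
theorem exists_equiv_of_sum_eq {α β : Type*} [Fintype α] [Fintype β] (W : α → β → ℕ) {d : ℕ}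
    (hd : 0 < d) (hrow : ∀ a, ∑ b, W a b = d) (hcol : ∀ b, ∑ a, W a b = d) :
    ∃ f : α ≃ β, ∀ a, 0 < W a (f a) := by
  classical
  have hcard : Fintype.card α = Fintype.card β := by
    have h₁ : ∑ a, ∑ b, W a b = Fintype.card α * d := by simp [hrow]
    have h₂ : ∑ b, ∑ a, W a b = Fintype.card β * d := by simp [hcol]
    rw [Finset.sum_comm, h₂] at h₁
    exact (Nat.eq_of_mul_eq_mul_right hd h₁).symm
  obtain ⟨f, hf, hW⟩ := (Finset.all_card_le_biUnion_card_iff_exists_injective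
    fun a => Finset.univ.filter fun b => 0 < W a b).1 fun s => by
      -- Hall's condition: the rows in `s` have the total `#s * d`, all of it in columns of `N`
      refine Nat.le_of_mul_le_mul_right ?_ hd
      set N := s.biUnion fun a => Finset.univ.filter fun b => 0 < W a b with hN
      calc s.card * d = ∑ a ∈ s, ∑ b, W a b := by simp [hrow]
        _ = ∑ a ∈ s, ∑ b ∈ N, W a b := by
          refine Finset.sum_congr rfl fun a ha => (Finset.sum_subset (Finset.subset_univ _) ?_).symm
          intro b _ hb
          by_contra h
          exact hb (Finset.mem_biUnion.2 ⟨a, ha, by simpa using Nat.pos_of_ne_zero h⟩)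
        _ = ∑ b ∈ N, ∑ a ∈ s, W a b := Finset.sum_comm
        _ ≤ ∑ b ∈ N, ∑ a, W a b :=
          Finset.sum_le_sum fun b _ => Finset.sum_le_sum_of_subset (Finset.subset_univ _)
        _ = N.card * d := by simp [hcol]
  refine ⟨Equiv.ofBijective f ((Fintype.bijective_iff_injective_and_card f).2 ⟨hf, hcard⟩),
    fun a => ?_⟩
  simpa using hW a

namespace SDMInstance

open DegreeFlow

variable {I : SDMInstance}

theorem adj_inl_iff {H : I.graph.Subgraph} {i : Fin I.m} {v : Fin I.m ⊕ Fin I.n} :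
    H.Adj (.inl i) v ↔ ∃ j, v = .inr j ∧ H.Adj (.inl i) (.inr j) := by
  refine ⟨fun h => ?_, by rintro ⟨j, rfl, h⟩; exact h⟩
  have := I.bipartite.mem_of_adj h.adj_sub
  rcases v with v | j
  · simp at this
  · exact ⟨j, rfl, h⟩

theorem adj_inr_iff {H : I.graph.Subgraph} {j : Fin I.n} {v : Fin I.m ⊕ Fin I.n} :
    H.Adj (.inr j) v ↔ ∃ i, v = .inl i ∧ H.Adj (.inl i) (.inr j) := by
  refine ⟨fun h => ?_, by rintro ⟨i, rfl, h⟩; exact h.symm⟩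
  have := I.bipartite.mem_of_adj h.adj_sub
  rcases v with i | v
  · exact ⟨i, rfl, h.symm⟩
  · simp at this

/-- The symmetric relation on the vertices that belongs to a relation between the parts. -/
def relAdj (r : Fin I.m → Fin I.n → Prop) : Fin I.m ⊕ Fin I.n → Fin I.m ⊕ Fin I.n → Prop
  | .inl i, .inr j => r i j
  | .inr j, .inl i => r i j
  | _, _ => False

/-- The subgraph without isolated vertices whose edges are given by a relation between the parts. -/
def ofRel (r : Fin I.m → Fin I.n → Prop) (hr : ∀ i j, r i j → I.graph.Adj (.inl i) (.inr j)) :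
    I.graph.Subgraph where
  verts := {v | ∃ w, relAdj r v w}
  Adj := relAdj r
  adj_sub {v w} h := by
    rcases v with i | j <;> rcases w with i' | j'
    · exact h.elim
    · exact hr _ _ h
    · exact (hr _ _ h).symm
    · exact h.elim
  edge_vert h := ⟨_, h⟩
  symm := ⟨fun v w h => by
    rcases v with i | j <;> rcases w with i' | j' <;> exact h⟩

theorem ofRel_isMatching {r : Fin I.m → Fin I.n → Prop}
    {hr : ∀ i j, r i j → I.graph.Adj (.inl i) (.inr j)}
    (h₁ : ∀ i j j', r i j → r i j' → j = j') (h₂ : ∀ i i' j, r i j → r i' j → i = i') :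
    (ofRel r hr).IsMatching := by
  rintro v ⟨w, hw⟩
  refine ⟨w, hw, fun w' hw' => ?_⟩
  rcases v with i | j <;> rcases w with i' | j' <;> rcases w' with i'' | j'' <;>
    first
    | exact hw.elim
    | exact hw'.elim
    | exact congrArg _ (h₁ _ _ _ hw' hw)
    | exact congrArg _ (h₂ _ _ _ hw' hw)

/-- The degree that is required at the vertex `x` of `X`. -/
def demand (I : SDMInstance) (x : ℕ) : ℕ :=
  if h : x < I.m then (if (⟨x, h⟩ : Fin I.m) ∈ I.S then 2 else 1) else 0

/-- A relation between the parts, as a set of pairs of numbers. -/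
noncomputable def pairs (r : Fin I.m → Fin I.n → Prop) : Finset (ℕ × ℕ) := by
  classical
  exact (Finset.univ.filter fun p : Fin I.m × Fin I.n => r p.1 p.2).image fun p => (p.1, p.2)

/-- The edges of an instance, as pairs of numbers. -/
noncomputable def edges (I : SDMInstance) : Finset (ℕ × ℕ) :=
  pairs fun i j => I.graph.Adj (.inl i) (.inr j)

theorem mem_pairs {r : Fin I.m → Fin I.n → Prop} {i : Fin I.m} {j : Fin I.n} :
    ((i : ℕ), (j : ℕ)) ∈ pairs r ↔ r i j := by
  simp only [pairs, Finset.mem_image, Finset.mem_filter, Finset.mem_univ, true_and, Prod.mk.injEq,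
    Prod.exists]
  constructor
  · rintro ⟨i', j', h, hi, hj⟩
    rwa [← Fin.ext hi, ← Fin.ext hj]
  · exact fun h => ⟨i, j, h, rfl, rfl⟩

theorem exists_of_mem_pairs {r : Fin I.m → Fin I.n → Prop} {p : ℕ × ℕ} (h : p ∈ pairs r) :
    ∃ (i : Fin I.m) (j : Fin I.n), p = (↑i, ↑j) ∧ r i j := by
  simp only [pairs, Finset.mem_image, Finset.mem_filter, Finset.mem_univ, true_and,
    Prod.exists] at h
  obtain ⟨i, j, h, rfl⟩ := h
  exact ⟨i, j, rfl, h⟩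

theorem row_pairs (r : Fin I.m → Fin I.n → Prop) (i : Fin I.m) :
    row (pairs r) i = {j | r i j}.ncard := by
  classical
  rw [row, ← Set.ncard_coe_finset]
  symm
  refine Set.ncard_congr (fun j _ => ((i : ℕ), (j : ℕ))) ?_ ?_ ?_
  · intro j h
    simpa [mem_pairs] using h
  · intro j j' _ _ h
    simpa [Fin.ext_iff] using h
  · rintro p hp
    simp only [Finset.coe_filter, Set.mem_ofPred_eq] at hp
    obtain ⟨i', j, rfl, h⟩ := exists_of_mem_pairs hp.1
    obtain rfl : i' = i := Fin.ext hp.2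
    exact ⟨j, h, rfl⟩

theorem col_pairs (r : Fin I.m → Fin I.n → Prop) (j : Fin I.n) :
    col (pairs r) j = {i | r i j}.ncard := by
  classical
  rw [col, ← Set.ncard_coe_finset]
  symm
  refine Set.ncard_congr (fun i _ => ((i : ℕ), (j : ℕ))) ?_ ?_ ?_
  · intro i h
    simpa [mem_pairs] using h
  · intro i i' _ _ h
    simpa [Fin.ext_iff] using h
  · rintro p hp
    simp only [Finset.coe_filter, Set.mem_ofPred_eq] at hp
    obtain ⟨i, j', rfl, h⟩ := exists_of_mem_pairs hp.1
    obtain rfl : j' = j := Fin.ext hp.2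
    exact ⟨i, h, rfl⟩

theorem isSolution_pairs {r : Fin I.m → Fin I.n → Prop}
    (hr : ∀ i j, r i j → I.graph.Adj (.inl i) (.inr j))
    (h₁ : ∀ i, {j | r i j}.ncard = if i ∈ I.S then 2 else 1) (h₂ : ∀ j, {i | r i j}.ncard ≤ 2) :
    IsSolution I.edges I.demand (pairs r) := by
  refine ⟨fun p hp => ?_, fun x => ?_, fun y => ?_⟩
  · obtain ⟨i, j, rfl, h⟩ := exists_of_mem_pairs hp
    exact mem_pairs.2 (hr i j h)
  · by_cases hx : x < I.m
    · have := row_pairs r ⟨x, hx⟩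
      rw [h₁] at this
      simpa [demand, hx] using this
    · simp only [row, demand, hx, dif_neg, not_false_eq_true, Finset.card_eq_zero,
        Finset.filter_eq_empty_iff]
      intro p hp
      obtain ⟨i, j, rfl, h⟩ := exists_of_mem_pairs hp
      rintro rfl
      exact hx i.2
  · by_cases hy : y < I.n
    · exact (col_pairs r ⟨y, hy⟩).trans_le (h₂ _)
    · rw [col, Finset.card_eq_zero.2]
      · exact Nat.zero_le _
      rw [Finset.filter_eq_empty_iff]
      intro p hp
      obtain ⟨i, j, rfl, h⟩ := exists_of_mem_pairs hp
      rintro rfl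
      exact hy j.2

theorem IsYes.exists_isSolution (h : I.IsYes) : ∃ F, IsSolution I.edges I.demand F := by
  classical
  obtain ⟨M₁, M₂, hM₁, hM₂, hdisj, hX, hS⟩ := h
  have hne : ∀ {v w}, M₁.Adj v w → ¬ M₂.Adj v w := fun {v w} h₁ h₂ =>
    Set.disjoint_left.1 hdisj (SimpleGraph.Subgraph.mem_edgeSet.2 h₁)
      (SimpleGraph.Subgraph.mem_edgeSet.2 h₂)
  have hM₁' : ∀ i, ∃ j, ∀ j', M₁.Adj (.inl i) (.inr j') ↔ j' = j := fun i => by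
    obtain ⟨w, hw, hu⟩ := hM₁ (hX ⟨i, rfl⟩)
    obtain ⟨j, rfl, h⟩ := adj_inl_iff.1 hw
    exact ⟨j, fun j' => ⟨fun h' => by simpa using hu _ h', by rintro rfl; exact h⟩⟩
  have hM₂' : ∀ i ∈ I.S, ∃ j, ∀ j', M₂.Adj (.inl i) (.inr j') ↔ j' = j := fun i hi => by
    obtain ⟨w, hw, hu⟩ := hM₂ (hS ⟨i, hi, rfl⟩)
    obtain ⟨j, rfl, h⟩ := adj_inl_iff.1 hw
    exact ⟨j, fun j' => ⟨fun h' => by simpa using hu _ h', by rintro rfl; exact h⟩⟩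
  refine ⟨_, isSolution_pairs
    (r := fun i j => M₁.Adj (.inl i) (.inr j) ∨ i ∈ I.S ∧ M₂.Adj (.inl i) (.inr j))
    (fun i j h => h.elim (fun h => h.adj_sub) fun h => h.2.adj_sub) (fun i => ?_) fun j => ?_⟩
  · obtain ⟨j, hj⟩ := hM₁' i
    split_ifs with hi
    · obtain ⟨j', hj'⟩ := hM₂' i hi
      have : j ≠ j' := by
        rintro rfl
        exact hne ((hj j).2 rfl) ((hj' j).2 rfl)
      rw [← Set.ncard_pair this]
      congr 1
      ext k
      simp [hj, hj', hi]
    · rw [← Set.ncard_singleton j]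
      congr 1
      ext k
      simp [hj, hi]
  · have hle : ∀ M : I.graph.Subgraph, M.IsMatching →
        {i | M.Adj (.inl i) (.inr j)}.ncard ≤ 1 := fun M hM => by
      refine (Set.ncard_le_one (Set.toFinite _)).2 fun i hi i' hi' => ?_
      have := hM.eq_of_adj_right hi hi'
      simpa using this
    calc _ ≤ ({i | M₁.Adj (.inl i) (.inr j)} ∪ {i | M₂.Adj (.inl i) (.inr j)}).ncard :=
          Set.ncard_le_ncard (fun i hi => hi.imp_right And.right) (Set.toFinite _)
      _ ≤ 1 + 1 := (Set.ncard_union_le _ _).trans (add_le_add (hle _ hM₁) (hle _ hM₂))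

theorem neighborSet_inl (H : I.graph.Subgraph) (i : Fin I.m) :
    H.neighborSet (.inl i) = Sum.inr '' {j | H.Adj (.inl i) (.inr j)} := by
  ext v
  rw [SimpleGraph.Subgraph.mem_neighborSet, adj_inl_iff]
  exact ⟨fun ⟨j, hv, h⟩ => ⟨j, h, hv.symm⟩, fun ⟨j, h, hv⟩ => ⟨j, hv.symm, h⟩⟩

theorem neighborSet_inr (H : I.graph.Subgraph) (j : Fin I.n) :
    H.neighborSet (.inr j) = Sum.inl '' {i | H.Adj (.inl i) (.inr j)} := by
  ext v
  rw [SimpleGraph.Subgraph.mem_neighborSet, adj_inr_iff]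
  exact ⟨fun ⟨j, hv, h⟩ => ⟨j, h, hv.symm⟩, fun ⟨j, h, hv⟩ => ⟨j, hv.symm, h⟩⟩

theorem isFactor_iff {H : I.graph.Subgraph} : IsFactor I.lower I.upper H ↔
    (∀ i, {j | H.Adj (.inl i) (.inr j)}.ncard = if i ∈ I.S then 2 else 1) ∧
      ∀ j, {i | H.Adj (.inl i) (.inr j)}.ncard ≤ 2 := by
  rw [IsFactor, Sum.forall]
  simp only [neighborSet_inl, neighborSet_inr, Set.ncard_image_of_injective _ Sum.inl_injective,
    Set.ncard_image_of_injective _ Sum.inr_injective, lower, upper, zero_le, true_and]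
  exact and_congr_left fun _ => forall_congr' fun i =>
    ⟨fun h => le_antisymm h.2 h.1, fun h => ⟨h.ge, h.le⟩⟩

theorem exists_isFactor_of_isSolution {F : Finset (ℕ × ℕ)} (hF : IsSolution I.edges I.demand F) :
    ∃ H : I.graph.Subgraph, IsFactor I.lower I.upper H := by
  have hr : ∀ (i : Fin I.m) (j : Fin I.n), (↑i, ↑j) ∈ F → I.graph.Adj (.inl i) (.inr j) :=
    fun i j h => (mem_pairs (r := fun i j => I.graph.Adj (.inl i) (.inr j))).1 (hF.subset h)
  have hpairs : pairs (fun (i : Fin I.m) (j : Fin I.n) => ((i : ℕ), (j : ℕ)) ∈ F) = F := by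
    ext p
    refine ⟨fun h => ?_, fun h => ?_⟩
    · obtain ⟨i, j, rfl, h'⟩ := exists_of_mem_pairs h
      exact h'
    · obtain ⟨i, j, rfl, -⟩ :=
        exists_of_mem_pairs (r := fun i j => I.graph.Adj (.inl i) (.inr j)) (hF.subset h)
      exact mem_pairs.2 h
  refine ⟨ofRel _ hr, isFactor_iff.2 ⟨fun i => ?_, fun j => ?_⟩⟩
  · have := row_pairs (fun (i : Fin I.m) (j : Fin I.n) => ((i : ℕ), (j : ℕ)) ∈ F) i
    rw [hpairs, hF.row_eq] at this
    refine this.symm.trans ?_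
    simp [demand]
  · have := col_pairs (fun (i : Fin I.m) (j : Fin I.n) => ((i : ℕ), (j : ℕ)) ∈ F) j
    rw [hpairs] at this
    exact this.symm.trans_le (hF.col_le j)


/-- A relation between the parts, extended to a matrix with all row and column sums equal to `2`:
the relation, a diagonal block for the missing degrees on each side, and the transpose. -/
noncomputable def doubled (r : Fin I.m → Fin I.n → Prop) [∀ i j, Decidable (r i j)] :
    Fin I.m ⊕ Fin I.n → Fin I.n ⊕ Fin I.m → ℕ
  | .inl i, .inl j => if r i j then 1 else 0
  | .inl i, .inr i' => if i = i' then 2 - {j | r i j}.ncard else 0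
  | .inr j, .inl j' => if j = j' then 2 - {i | r i j}.ncard else 0
  | .inr j, .inr i => if r i j then 1 else 0

theorem exists_equiv_doubled {r : Fin I.m → Fin I.n → Prop} [∀ i j, Decidable (r i j)]
    (h₁ : ∀ i, {j | r i j}.ncard ≤ 2) (h₂ : ∀ j, {i | r i j}.ncard ≤ 2) :
    ∃ f : Fin I.m ⊕ Fin I.n ≃ Fin I.n ⊕ Fin I.m, ∀ a, 0 < doubled r a (f a) := by
  have hi : ∀ i, ∑ j, (if r i j then 1 else 0) = {j | r i j}.ncard := fun i => by
    simp [Set.ncard_eq_toFinset_card']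
  have hj : ∀ j, ∑ i, (if r i j then 1 else 0) = {i | r i j}.ncard := fun j => by
    simp [Set.ncard_eq_toFinset_card']
  refine exists_equiv_of_sum_eq (doubled r) two_pos (fun a => ?_) fun b => ?_
  · rcases a with i | j
    · simp only [Fintype.sum_sum_type, doubled, hi, Finset.sum_ite_eq, Finset.mem_univ, if_true]
      exact Nat.add_sub_cancel' (h₁ i)
    · simp only [Fintype.sum_sum_type, doubled, hj, Finset.sum_ite_eq, Finset.mem_univ, if_true]
      exact Nat.sub_add_cancel (h₂ j)
  · rcases b with j | i
    · simp only [Fintype.sum_sum_type, doubled, hj, Finset.sum_ite_eq', Finset.mem_univ, if_true]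
      exact Nat.add_sub_cancel' (h₂ j)
    · simp only [Fintype.sum_sum_type, doubled, hi, Finset.sum_ite_eq', Finset.mem_univ, if_true]
      exact Nat.sub_add_cancel (h₁ i)

theorem eq_of_ncard_le_two {α : Type*} [Finite α] {s : Set α} (h : s.ncard ≤ 2) {a b c : α}
    (ha : a ∈ s) (hb : b ∈ s) (hc : c ∈ s) (hac : c ≠ a) (hbc : c ≠ b) : a = b := by
  by_contra hab
  have h₁ : ({c, a, b} : Set α).ncard ≤ s.ncard := Set.ncard_le_ncard
    (by rintro x (rfl | rfl | rfl) <;> assumption) (Set.toFinite _)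
  rw [Set.ncard_insert_of_notMem (by simp [hac, hbc]), Set.ncard_pair hab] at h₁
  omega

theorem IsLarge.eq_of_notMem (hI : I.IsLarge) {i i' : Fin I.m} (hi : i ∉ I.S) (hi' : i' ∉ I.S) :
    i = i' := by
  have h : I.Sᶜ.card ≤ 1 := by
    rw [Finset.card_compl, Fintype.card_fin]
    unfold IsLarge at hI
    omega
  exact Finset.card_le_one.1 h i (by simpa using hi) i' (by simpa using hi')

/-- The edges of a factor split into two matchings, both of which cover `S`, while every other
vertex of `X` is covered by one of them. As there is at most one such vertex, the first matching may
be assumed to cover it. -/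
theorem isYes_of_isFactor (hI : I.IsLarge) {H : I.graph.Subgraph}
    (hH : IsFactor I.lower I.upper H) : I.IsYes := by
  classical
  obtain ⟨hrow, hcol⟩ := isFactor_iff.1 hH
  set r : Fin I.m → Fin I.n → Prop := fun i j => H.Adj (.inl i) (.inr j) with hr
  have hrow' : ∀ i, {j | r i j}.ncard ≤ 2 := fun i => by
    rw [hrow]
    split_ifs <;> simp
  obtain ⟨f, hf⟩ := exists_equiv_doubled hrow' hcol
  have hadj : ∀ i j, r i j → I.graph.Adj (.inl i) (.inr j) := fun i j h => h.adj_sub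
  let M₁ := ofRel (fun i j => r i j ∧ f (.inl i) = .inl j) fun i j h => hadj i j h.1
  let M₂ := ofRel (fun i j => r i j ∧ f (.inl i) ≠ .inl j) fun i j h => hadj i j h.1
  have hM₁ : M₁.IsMatching := by
    refine ofRel_isMatching (fun i j j' h h' => ?_) fun i i' j h h' => ?_
    · simpa using h.2.symm.trans h'.2
    · simpa using f.injective (h.2.trans h'.2.symm)
  have hM₂ : M₂.IsMatching := by
    refine ofRel_isMatching (fun i j j' h h' => ?_) fun i i' j h h' => ?_
    · -- either `f` takes another edge at `i`, or the diagonal entry shows that `i` has only one edge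
      have hpos := hf (.inl i)
      rcases hfi : f (.inl i) with k | i'
      · rw [hfi] at hpos h h'
        have hk : r i k := by
          by_contra hk
          simp [doubled, hk] at hpos
        exact eq_of_ncard_le_two (hrow' i) h.1 h'.1 hk (by simpa using h.2) (by simpa using h'.2)
      · rw [hfi] at hpos
        have hle : {j | r i j}.ncard ≤ 1 := by
          simp only [doubled] at hpos
          split_ifs at hpos <;> omega
        exact (Set.ncard_le_one (Set.toFinite _)).1 hle j h.1 j' h'.1
    · obtain ⟨a, ha⟩ := f.surjective (.inl j)
      have hpos := hf a
      rw [ha] at hpos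
      rcases a with k | j'
      · have hk : r k j := by
          by_contra hk
          simp [doubled, hk] at hpos
        exact eq_of_ncard_le_two (hcol j) h.1 h'.1 hk (by rintro rfl; exact h.2 ha)
          (by rintro rfl; exact h'.2 ha)
      · obtain rfl : j' = j := by
          by_contra hne
          simp [doubled, hne] at hpos
        have hle : {i | r i j'}.ncard ≤ 1 := by
          simp only [doubled, if_true] at hpos
          omega
        exact (Set.ncard_le_one (Set.toFinite _)).1 hle i h.1 i' h'.1
  have hdisj : Disjoint M₁.edgeSet M₂.edgeSet := by
    rw [Set.disjoint_left]
    intro e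
    induction e with | _ v w
    rw [SimpleGraph.Subgraph.mem_edgeSet, SimpleGraph.Subgraph.mem_edgeSet]
    rcases v with i | j <;> rcases w with i' | j'
    · exact fun h => h.elim
    · exact fun h h' => h'.2 h.2
    · exact fun h h' => h'.2 h.2
    · exact fun h => h.elim
  have hcover : ∀ i, .inl i ∈ M₁.verts ∨ .inl i ∈ M₂.verts := fun i => by
    have hne : {j | r i j}.Nonempty := by
      rw [← Set.ncard_pos (Set.toFinite _), hrow]
      split_ifs <;> simp
    obtain ⟨j, hj⟩ := hne
    by_cases h : f (.inl i) = .inl j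
    · exact Or.inl ⟨.inr j, hj, h⟩
    · exact Or.inr ⟨.inr j, hj, h⟩
  have hcoverS : ∀ i ∈ I.S, .inl i ∈ M₁.verts ∧ .inl i ∈ M₂.verts := fun i hi => by
    have h₂ : {j | r i j}.ncard = 2 := by rw [hrow, if_pos hi]
    have hpos := hf (.inl i)
    rcases hfi : f (.inl i) with k | i'
    · rw [hfi] at hpos
      have hk : r i k := by
        by_contra hk
        simp [doubled, hk] at hpos
      obtain ⟨j, hj, hjk⟩ := Set.exists_ne_of_one_lt_ncard (by rw [h₂]; exact one_lt_two) k
      exact ⟨⟨.inr k, hk, hfi⟩, ⟨.inr j, hj, by simpa [hfi] using hjk.symm⟩⟩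
    · rw [hfi] at hpos
      simp [doubled, h₂] at hpos
  by_cases hX : ∀ i, .inl i ∈ M₁.verts
  · refine ⟨M₁, M₂, hM₁, hM₂, hdisj, ?_, ?_⟩
    · rintro _ ⟨i, rfl⟩
      exact hX i
    · rintro _ ⟨i, hi, rfl⟩
      exact (hcoverS i hi).2
  · push Not at hX
    obtain ⟨i₀, hi₀⟩ := hX
    have hi₀S : i₀ ∉ I.S := fun h => hi₀ (hcoverS i₀ h).1
    refine ⟨M₂, M₁, hM₂, hM₁, hdisj.symm, ?_, ?_⟩
    · rintro _ ⟨i, rfl⟩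
      by_cases hi : i ∈ I.S
      · exact (hcoverS i hi).2
      · rw [hI.eq_of_notMem hi hi₀S]
        exact (hcover i₀).resolve_left hi₀
    · rintro _ ⟨i, hi, rfl⟩
      exact (hcoverS i hi).1

theorem isYes_iff_exists_isFactor (hI : I.IsLarge) :
    I.IsYes ↔ ∃ H : I.graph.Subgraph, IsFactor I.lower I.upper H :=
  ⟨fun h => h.exists_isSolution.elim fun _ hF => exists_isFactor_of_isSolution hF,
    fun ⟨_, hH⟩ => isYes_of_isFactor hI hH⟩

theorem isYes_iff_exists_isSolution (hI : I.IsLarge) :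
    I.IsYes ↔ ∃ F, IsSolution I.edges I.demand F :=
  ⟨IsYes.exists_isSolution, fun ⟨_, hF⟩ =>
    (exists_isFactor_of_isSolution hF).elim fun _ hH => isYes_of_isFactor hI hH⟩

end SDMInstance

/-! ### Reasoning about loop programs -/

namespace StackProgram

namespace Prog

variable {V Q G : Type} {N : ℕ}

/-- The memory `mem` with the content of one cell replaced. -/
def set (mem : ℕ → ℕ → G) (x y : ℕ) (g : G) : ℕ → ℕ → G :=
  Function.update mem x (Function.update (mem x) y g)

theorem set_apply (mem : ℕ → ℕ → G) (x y : ℕ) (g : G) (x' y' : ℕ) :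
    set mem x y g x' y' = if x' = x ∧ y' = y then g else mem x' y' := by
  unfold set
  by_cases hx : x' = x
  · subst hx
    by_cases hy : y' = y
    · subst hy; simp
    · simp [hy]
  · simp [hx]

@[simp]
theorem set_self (mem : ℕ → ℕ → G) (x y : ℕ) : set mem x y (mem x y) = mem := by
  simp [set]

/-- Do nothing. -/
def skip : Prog V Q G := load id

/-- Inspect a cell. -/
def look (i j : V) (f : Q → G → Q) : Prog V Q G := act i j fun q g => (f q g, g)

/-- Modify a cell. -/
def alter (i j : V) (f : G → G) : Prog V Q G := act i j fun q g => (q, f g)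

@[simp]
theorem keeps_skip (v : V) : (skip : Prog V Q G).Keeps v := trivial

@[simp]
theorem keeps_look (v i j : V) (f : Q → G → Q) : (look i j f).Keeps v := trivial

@[simp]
theorem keeps_alter (v i j : V) (f : G → G) : (alter i j f : Prog V Q G).Keeps v := trivial

variable [DecidableEq V]

@[simp]
theorem eval_skip (e : Env V Q G) : (skip : Prog V Q G).eval N e = e := rfl

@[simp]
theorem eval_look (i j : V) (f : Q → G → Q) (e : Env V Q G) :
    (look i j f).eval N e = { e with q := f e.q (e.mem (e.reg i) (e.reg j)) } := by
  simp [look, eval]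

@[simp]
theorem eval_alter (i j : V) (f : G → G) (e : Env V Q G) : (alter i j f).eval N e =
    { e with mem := set e.mem (e.reg i) (e.reg j) (f (e.mem (e.reg i) (e.reg j))) } := rfl

/-- Rule for loops: a property `P i` of control state and memory that is preserved by the body, from
the number `i` of the pass to `i + 1`, holds for `N` at the end. -/
theorem eval_each {P : ℕ → Q → (ℕ → ℕ → G) → Prop} {v : V} {a : Prog V Q G} {e : Env V Q G}
    (hv : a.Keeps v) (h₀ : P 0 e.q e.mem)
    (h : ∀ i < N, ∀ e' : Env V Q G, e'.reg v = i → (∀ u, u ≠ v → a.Keeps u → e'.reg u = e.reg u) →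
      P i e'.q e'.mem → P (i + 1) (a.eval N e').q (a.eval N e').mem) :
    P N ((each v a).eval N e).q ((each v a).eval N e).mem := by
  set f : Env V Q G → Env V Q G := fun e => { eval N a e with
    reg := Function.update (eval N a e).reg v (min ((eval N a e).reg v + 1) N) } with hf
  have key : ∀ i ≤ N, (f^[i] { e with reg := Function.update e.reg v 0 }).reg v = i ∧
      (∀ u, u ≠ v → a.Keeps u →
        (f^[i] { e with reg := Function.update e.reg v 0 }).reg u = e.reg u) ∧
      P i (f^[i] { e with reg := Function.update e.reg v 0 }).q
        (f^[i] { e with reg := Function.update e.reg v 0 }).mem := by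
    intro i
    induction i with
    | zero => exact fun _ => ⟨by simp, fun u hu _ => by simp [hu], h₀⟩
    | succ i ih =>
      intro hi
      obtain ⟨h₁, h₂, h₃⟩ := ih (by omega)
      rw [Function.iterate_succ_apply']
      refine ⟨?_, fun u hu hk => ?_, h i (by omega) _ h₁ h₂ h₃⟩
      · refine (Function.update_self _ _ _).trans ?_
        rw [hv.reg_eval, h₁]
        omega
      · refine (Function.update_of_ne hu _ _).trans ?_
        rw [hk.reg_eval, h₂ u hu hk]
  exact (key N le_rfl).2.2

end Prog

end StackProgram

/-! ### The program for the decision problem -/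

namespace SDMProgram

open StackProgram Prog DegreeFlow Relation

/-- The registers. The register `o` is always `0`. -/
inductive Reg : Type
  | x | y | z | l | c | o | r₁ | r₂ | p
  deriving DecidableEq

instance : Fintype Reg :=
  ⟨{.x, .y, .z, .l, .c, .o, .r₁, .r₂, .p}, fun v => by cases v <;> decide⟩

/-- The part of the input that is being read: `|Y|`, the first symbol of a row, or the rest of a
row. -/
inductive Phase : Type
  | header | start | row
  deriving DecidableEq, Inhabited

instance : Fintype Phase := ⟨{.header, .start, .row}, fun v => by cases v <;> decide⟩

/-- The control states. -/
structure State : Type where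
  phase : Phase
  sym : Option Bool
  need : Fin 3
  cnt : Fin 3
  want : Bool
  go : Bool
  bit : Bool
  lt : Bool
  flag : Bool
  ok : Bool
  deriving Inhabited

noncomputable instance : Fintype State :=
  Fintype.ofInjective
    (fun q => (q.phase, q.sym, q.need, q.cnt, q.want, q.go, q.bit, q.lt, q.flag, q.ok))
    fun q q' h => by
      cases q
      cases q'
      simpa using h

/-- The memory cells. The cell in row `x` and column `y` tells whether `xy` is an edge and whether
it is chosen, and whether the level of `x` is greater than `y`. The cell in row `x` and column `0`
also tells whether there is a vertex `x`, and whether it is in `S`. -/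
structure Cell : Type where
  adj : Bool
  held : Bool
  lev : Bool
  ex : Bool
  inS : Bool
  deriving Fintype

instance : Inhabited Cell := ⟨⟨false, false, false, false, false⟩⟩

/-- The required degree. -/
def Cell.demand (g : Cell) : Fin 3 := if g.ex then (if g.inS then 2 else 1) else 0

/-- Count the edges that are missing at `x`. -/
def computeNeed : Prog Reg State Cell :=
  .seq (look .x .o fun q g => { q with need := g.demand })
    (.each .c (look .x .c fun q g =>
      { q with need := if g.held then ⟨q.need - 1, by omega⟩ else q.need }))

/-- Count the chosen edges at `y`, up to two. -/
def computeCount : Prog Reg State Cell :=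
  .seq (.load fun q => { q with cnt := 0 })
    (.each .z (look .z .y fun q g =>
      { q with cnt := if g.held then ⟨min (q.cnt + 1) 2, by omega⟩ else q.cnt }))

/-- Compare the levels of `z` and `x`. -/
def compare : Prog Reg State Cell :=
  .seq (.load fun q => { q with lt := false })
    (.each .l (.seq (look .x .l fun q g => { q with bit := g.lev })
      (look .z .l fun q g => { q with lt := q.lt || (q.bit && !g.lev) })))

/-- If wanted, give `x` the place at `y` of some `z` of smaller level. -/
def search : Prog Reg State Cell :=
  .each .z (.seq compare (.seq
    (look .z .y fun q g => { q with go := q.want && q.lt && g.held })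
    (.ite State.go
      (.seq (alter .z .y fun g => { g with held := false })
        (.seq (alter .x .y fun g => { g with held := true })
          (.load fun q => { q with want := false })))
      skip)))

/-- Try to choose the edge `xy`. -/
def tryEdge : Prog Reg State Cell :=
  .seq computeNeed (.seq computeCount (.seq
    (look .x .y fun q g => { q with want := decide (q.need ≠ 0) && g.adj && !g.held })
    (.ite (fun q => q.want && decide (q.cnt ≠ 2))
      (alter .x .y fun g => { g with held := true }) search)))

/-- Increase the level of `x`. -/
def raise : Prog Reg State Cell :=
  .seq (.load fun q => { q with flag := true })
    (.each .l (.act .x .l fun q g =>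
      ({ q with flag := q.flag && g.lev }, { g with lev := g.lev || q.flag })))

/-- Try all edges at `x`, and increase the level of `x` if it still has not enough edges. -/
def turn : Prog Reg State Cell :=
  .seq (.each .y tryEdge) (.seq computeNeed (.ite (fun q => decide (q.need ≠ 0)) raise skip))

/-- Read one symbol of the input. -/
def parse : Prog Reg State Cell :=
  .seq (.read fun q a => { q with sym := a.getD none })
    (.ite (fun q => decide (q.phase = .header))
      (.load fun q => { q with phase := if q.sym = none then .start else .header })
      (.ite (fun q => decide (q.phase = .start))
        (.seq (.act .x .o fun q g => ({ q with phase := .row },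
          { g with ex := true, inS := decide (q.sym = some true) })) (.clr .y))
        (.ite (fun q => decide (q.sym = none))
          (.seq (.load fun q => { q with phase := .start }) (.inc .x))
          (.seq (.act .x .y fun q g => (q, { g with adj := decide (q.sym = some true) }))
            (.inc .y)))))

/-- Test whether all vertices have enough edges. -/
def final : Prog Reg State Cell :=
  .seq (.load fun q => { q with ok := true })
    (.each .x (.seq computeNeed (.load fun q => { q with ok := q.ok && decide (q.need = 0) })))

/-- The program: read the input, execute `N ^ 2` rounds of turns of all vertices, and test the
result. -/
def main : Prog Reg State Cell :=
  .seq (.each .p parse) (.seq (.each .r₁ (.each .r₂ (.each .x turn))) final)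

@[simp]
theorem keeps_computeNeed {v : Reg} : computeNeed.Keeps v ↔ v ≠ .c := by
  cases v <;> simp [computeNeed, Keeps]

@[simp]
theorem keeps_computeCount {v : Reg} : computeCount.Keeps v ↔ v ≠ .z := by
  cases v <;> simp [computeCount, Keeps]

@[simp]
theorem keeps_compare {v : Reg} : compare.Keeps v ↔ v ≠ .l := by
  cases v <;> simp [compare, Keeps]

@[simp]
theorem keeps_search {v : Reg} : search.Keeps v ↔ v ≠ .z ∧ v ≠ .l := by
  cases v <;> simp [search, Keeps]

@[simp]
theorem keeps_tryEdge {v : Reg} : tryEdge.Keeps v ↔ v ≠ .c ∧ v ≠ .z ∧ v ≠ .l := by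
  cases v <;> simp [tryEdge, Keeps]

@[simp]
theorem keeps_raise {v : Reg} : raise.Keeps v ↔ v ≠ .l := by
  cases v <;> simp [raise, Keeps]

@[simp]
theorem keeps_turn {v : Reg} : turn.Keeps v ↔ v ≠ .y ∧ v ≠ .c ∧ v ≠ .z ∧ v ≠ .l := by
  cases v <;> simp [turn, Keeps]

theorem main_wellFormed : main.WellFormed := by
  simp [main, final, parse, turn, raise, tryEdge, search, compare, computeCount, computeNeed,
    WellFormed, Keeps, look, alter, skip]

/-! ### The program follows the push-relabel algorithm -/

/-- The memory represents a graph with degree bounds and a stage of the algorithm. -/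
structure Rep (A : Finset (ℕ × ℕ)) (b : ℕ → ℕ) (N : ℕ) (mem : ℕ → ℕ → Cell) (s : Stage) :
    Prop where
  edge_lt : ∀ x y, (x, y) ∈ A → x < N ∧ y < N
  held_lt : ∀ x y, (x, y) ∈ s.H → x < N ∧ y < N
  lev_le : ∀ x, s.lev x ≤ N
  adj : ∀ x < N, ∀ y < N, (mem x y).adj = true ↔ (x, y) ∈ A
  held : ∀ x < N, ∀ y < N, (mem x y).held = true ↔ (x, y) ∈ s.H
  lev : ∀ x < N, ∀ y < N, (mem x y).lev = true ↔ y < s.lev x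
  demand : ∀ x < N, ((mem x 0).demand : ℕ) = b x

variable {A : Finset (ℕ × ℕ)} {b : ℕ → ℕ} {N : ℕ} {mem : ℕ → ℕ → Cell} {s s' : Stage}
  {e : Env Reg State Cell} {m : ℕ}

theorem Rep.setHeld (h : Rep A b N mem s) {x y : ℕ} (hx : x < N) (hy : y < N) :
    Rep A b N (set mem x y { mem x y with held := true }) ⟨insert (x, y) s.H, s.lev⟩ where
  edge_lt := h.edge_lt
  held_lt x' y' hp := by
    rcases Finset.mem_insert.1 hp with hp | hp
    · obtain ⟨rfl, rfl⟩ := Prod.mk.inj hp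
      exact ⟨hx, hy⟩
    · exact h.held_lt _ _ hp
  lev_le := h.lev_le
  adj x' hx' y' hy' := by
    rw [set_apply, ← h.adj x' hx' y' hy']
    split_ifs with hp
    · rw [hp.1, hp.2]
    · rfl
  held x' hx' y' hy' := by
    rw [set_apply, Finset.mem_insert, ← h.held x' hx' y' hy', Prod.mk.injEq]
    split_ifs with hp <;> simp [hp]
  lev x' hx' y' hy' := by
    rw [set_apply, ← h.lev x' hx' y' hy']
    split_ifs with hp
    · rw [hp.1, hp.2]
    · rfl
  demand x' hx' := by
    rw [set_apply, ← h.demand x' hx']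
    split_ifs with hp
    · rw [hp.1, hp.2]; rfl
    · rfl

theorem Rep.clearHeld (h : Rep A b N mem s) (x y : ℕ) :
    Rep A b N (set mem x y { mem x y with held := false }) ⟨s.H.erase (x, y), s.lev⟩ where
  edge_lt := h.edge_lt
  held_lt x' y' hp := h.held_lt _ _ (Finset.mem_of_mem_erase hp)
  lev_le := h.lev_le
  adj x' hx' y' hy' := by
    rw [set_apply, ← h.adj x' hx' y' hy']
    split_ifs with hp
    · rw [hp.1, hp.2]
    · rfl
  held x' hx' y' hy' := by
    rw [set_apply, Finset.mem_erase, ← h.held x' hx' y' hy', Ne, Prod.mk.injEq]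
    split_ifs with hp <;> simp [hp]
  lev x' hx' y' hy' := by
    rw [set_apply, ← h.lev x' hx' y' hy']
    split_ifs with hp
    · rw [hp.1, hp.2]
    · rfl
  demand x' hx' := by
    rw [set_apply, ← h.demand x' hx']
    split_ifs with hp
    · rw [hp.1, hp.2]; rfl
    · rfl

theorem Rep.setLev (h : Rep A b N mem s) {x : ℕ} (hx : s.lev x < N) :
    Rep A b N (set mem x (s.lev x) { mem x (s.lev x) with lev := true })
      ⟨s.H, Function.update s.lev x (s.lev x + 1)⟩ where
  edge_lt := h.edge_lt
  held_lt := h.held_lt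
  lev_le x' := by
    rcases eq_or_ne x' x with rfl | hne
    · simpa using hx
    · simpa [hne] using h.lev_le x'
  adj x' hx' y' hy' := by
    rw [set_apply, ← h.adj x' hx' y' hy']
    split_ifs with hp
    · rw [hp.1, hp.2]
    · rfl
  held x' hx' y' hy' := by
    rw [set_apply, ← h.held x' hx' y' hy']
    split_ifs with hp
    · rw [hp.1, hp.2]
    · rfl
  lev x' hx' y' hy' := by
    have := h.lev x' hx' y' hy'
    rw [set_apply]
    rcases eq_or_ne x' x with rfl | hne
    · simp only [true_and, Function.update_self]
      split_ifs with hp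
      · simp [hp]
      · rw [this]; omega
    · simpa [hne] using this
  demand x' hx' := by
    rw [set_apply, ← h.demand x' hx']
    split_ifs with hp
    · rw [hp.1, hp.2]; rfl
    · rfl

theorem row_eq_sum {H : Finset (ℕ × ℕ)} (h : ∀ x y, (x, y) ∈ H → x < N ∧ y < N) (x : ℕ) :
    row H x = ∑ y ∈ Finset.range N, if (x, y) ∈ H then 1 else 0 := by
  rw [← Finset.card_filter, row]
  refine (Finset.card_bij (fun y _ => (x, y)) ?_ ?_ ?_).symm
  · intro y hy
    simpa using (Finset.mem_filter.1 hy).2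
  · intro y _ y' _ hyy
    simpa using hyy
  · rintro ⟨x', y⟩ hp
    obtain ⟨hp', rfl⟩ := Finset.mem_filter.1 hp
    exact ⟨y, by simpa [hp'] using (h _ _ hp').2, rfl⟩

theorem col_eq_sum {H : Finset (ℕ × ℕ)} (h : ∀ x y, (x, y) ∈ H → x < N ∧ y < N) (y : ℕ) :
    col H y = ∑ x ∈ Finset.range N, if (x, y) ∈ H then 1 else 0 := by
  rw [← Finset.card_filter, col]
  refine (Finset.card_bij (fun x _ => (x, y)) ?_ ?_ ?_).symm
  · intro x hx
    simpa using (Finset.mem_filter.1 hx).2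
  · intro x _ x' _ hxx
    simpa using hxx
  · rintro ⟨x, y'⟩ hp
    obtain ⟨hp', rfl⟩ := Finset.mem_filter.1 hp
    exact ⟨x, by simpa [hp'] using (h _ _ hp').1, rfl⟩

theorem Rep.eval_computeNeed (h : Rep A b N e.mem s) (ho : e.reg .o = 0) (hx : e.reg .x < N) :
    (computeNeed.eval N e).mem = e.mem ∧ ∃ k : Fin 3, (k : ℕ) = b (e.reg .x) - row s.H (e.reg .x) ∧
      (computeNeed.eval N e).q = { e.q with need := k } := by
  obtain ⟨hm, k, hk, hq⟩ := eval_each (N := N) (v := Reg.c)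
    (e := { e with q := { e.q with need := (e.mem (e.reg .x) 0).demand } })
    (a := look .x .c fun (q : State) (g : Cell) =>
      { q with need := if g.held then ⟨q.need - 1, by omega⟩ else q.need })
    (P := fun i q mem => mem = e.mem ∧ ∃ k : Fin 3, (k : ℕ) = b (e.reg .x) -
      (∑ y ∈ Finset.range i, if (e.reg .x, y) ∈ s.H then 1 else 0) ∧ q = { e.q with need := k })
    trivial ⟨rfl, _, by simpa using h.demand _ hx, rfl⟩ (by
      rintro i hi e' hu hreg ⟨hm, k, hk, hq⟩
      have hx' : e'.reg .x = e.reg .x := hreg .x (by decide) trivial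
      rw [eval_look]
      refine ⟨hm, _, ?_, by rw [hq]⟩
      have := h.held _ hx i hi
      simp only [hm, hx', hu, Finset.sum_range_succ, this]
      split_ifs
      · simp only
        omega
      · simpa using hk)
  rw [← row_eq_sum h.held_lt] at hk
  simp only [computeNeed, Prog.eval, eval_look, ho] at hm hq ⊢
  exact ⟨hm, k, hk, hq⟩

theorem Rep.eval_computeCount (h : Rep A b N e.mem s) (hy : e.reg .y < N) :
    (computeCount.eval N e).mem = e.mem ∧ ∃ k : Fin 3, (k : ℕ) = min (col s.H (e.reg .y)) 2 ∧
      (computeCount.eval N e).q = { e.q with cnt := k } := by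
  obtain ⟨hm, k, hk, hq⟩ := eval_each (N := N) (v := Reg.z)
    (e := { e with q := { e.q with cnt := 0 } })
    (a := look .z .y fun (q : State) (g : Cell) =>
      { q with cnt := if g.held then ⟨min (q.cnt + 1) 2, by omega⟩ else q.cnt })
    (P := fun i q mem => mem = e.mem ∧ ∃ k : Fin 3, (k : ℕ) =
      min (∑ x ∈ Finset.range i, if (x, e.reg .y) ∈ s.H then 1 else 0) 2 ∧ q = { e.q with cnt := k })
    trivial ⟨rfl, _, by simp, rfl⟩ (by
      rintro i hi e' hz hreg ⟨hm, k, hk, hq⟩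
      have hy' : e'.reg .y = e.reg .y := hreg .y (by decide) trivial
      rw [eval_look]
      refine ⟨hm, _, ?_, by rw [hq]⟩
      have := h.held i hi _ hy
      simp only [hm, hy', hz, Finset.sum_range_succ, this]
      split_ifs
      · simp only
        omega
      · simpa using hk)
  rw [← col_eq_sum h.held_lt] at hk
  exact ⟨hm, k, hk, hq⟩

theorem Rep.eval_compare (h : Rep A b N e.mem s) (hx : e.reg .x < N) (hz : e.reg .z < N) :
    (compare.eval N e).mem = e.mem ∧ (compare.eval N e).q.want = e.q.want ∧
      (compare.eval N e).q.lt = decide (s.lev (e.reg .z) < s.lev (e.reg .x)) := by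
  obtain ⟨hm, hw, hlt⟩ := eval_each (N := N) (v := Reg.l)
    (e := { e with q := { e.q with lt := false } })
    (a := .seq (look .x .l fun (q : State) (g : Cell) => { q with bit := g.lev })
      (look .z .l fun q g => { q with lt := q.lt || (q.bit && !g.lev) }))
    (P := fun i q mem => mem = e.mem ∧ q.want = e.q.want ∧
      (q.lt = true ↔ s.lev (e.reg .z) < min i (s.lev (e.reg .x))))
    ⟨trivial, trivial⟩ ⟨rfl, rfl, by simp⟩ (by
      rintro i hi e' hl hreg ⟨hm, hw, hlt⟩
      have hx' : e'.reg .x = e.reg .x := hreg .x (by decide) ⟨trivial, trivial⟩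
      have hz' : e'.reg .z = e.reg .z := hreg .z (by decide) ⟨trivial, trivial⟩
      simp only [Prog.eval, eval_look]
      refine ⟨hm, hw, ?_⟩
      have h₁ := h.lev _ hx i hi
      have h₂ := h.lev _ hz i hi
      simp only [Bool.or_eq_true, Bool.and_eq_true, Bool.not_eq_true', ← Bool.not_eq_true, hm, hx',
        hz', hl, h₁, h₂, hlt]
      omega)
  refine ⟨hm, hw, ?_⟩
  rw [min_eq_right (h.lev_le _)] at hlt
  exact Bool.eq_iff_iff.2 (hlt.trans (by simp))

/-- The edges at `y` are tried in vain: if `xy` is not chosen and `x` has not enough edges, then `y`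
is full and all its users have at least the level of `x`. -/
def Blocked (A : Finset (ℕ × ℕ)) (b : ℕ → ℕ) (s : Stage) (x y : ℕ) : Prop :=
  (x, y) ∈ A → (x, y) ∉ s.H → row s.H x < b x →
    2 ≤ col s.H y ∧ ∀ z, (z, y) ∈ s.H → s.lev x ≤ s.lev z

/-- Only edges at `y` are changed, and `x` loses no edge. -/
structure Frame (x y : ℕ) (s s' : Stage) : Prop where
  lev_eq : s'.lev = s.lev
  mem_iff : ∀ y' ≠ y, ∀ z, (z, y') ∈ s'.H ↔ (z, y') ∈ s.H
  mem_of_mem : ∀ y', (x, y') ∈ s.H → (x, y') ∈ s'.H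

theorem Frame.refl (x y : ℕ) (s : Stage) : Frame x y s s :=
  ⟨rfl, fun _ _ _ => Iff.rfl, fun _ => id⟩

theorem Frame.row_le {x y : ℕ} (h : Frame x y s s') : row s.H x ≤ row s'.H x := by
  refine Finset.card_le_card fun p hp => ?_
  obtain ⟨hp', rfl⟩ := Finset.mem_filter.1 hp
  exact Finset.mem_filter.2 ⟨h.mem_of_mem _ hp', rfl⟩

theorem Frame.blocked {x y y' : ℕ} (h : Frame x y s s') (hy : y' ≠ y) (hb : Blocked A b s x y') :
    Blocked A b s' x y' := by
  intro hA hH hr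
  obtain ⟨h₁, h₂⟩ := hb hA (by rwa [← h.mem_iff y' hy]) (h.row_le.trans_lt hr)
  have : col s'.H y' = col s.H y' := by
    unfold col
    congr 1
    ext ⟨z, w⟩
    simp only [Finset.mem_filter, and_congr_left_iff]
    rintro rfl
    exact h.mem_iff _ hy z
  rw [this, h.lev_eq]
  exact ⟨h₁, fun z hz => h₂ z ((h.mem_iff y' hy z).1 hz)⟩

/-- The search at `y` leaves the edge `xy` blocked. The hypothesis covers both the case that a place
is wanted and the case that there is nothing to do. -/
theorem Rep.eval_search (h : Rep A b N e.mem s) (hx : e.reg .x < N) (hy : e.reg .y < N)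
    (hw : if e.q.want then (e.reg .x, e.reg .y) ∈ A ∧ (e.reg .x, e.reg .y) ∉ s.H ∧
        row s.H (e.reg .x) < b (e.reg .x) ∧ 2 ≤ col s.H (e.reg .y)
      else Blocked A b s (e.reg .x) (e.reg .y)) :
    ∃ s', Rep A b N (search.eval N e).mem s' ∧ ReflTransGen (Step A b) s s' ∧
      Frame (e.reg .x) (e.reg .y) s s' ∧ Blocked A b s' (e.reg .x) (e.reg .y) := by
  set x := e.reg .x with hxdef
  set y := e.reg .y with hydef
  obtain ⟨s', hs', hst, hf, hw'⟩ := eval_each (N := N) (v := Reg.z) (e := e)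
    (a := .seq compare (.seq
      (look .z .y fun (q : State) (g : Cell) => { q with go := q.want && q.lt && g.held })
      (.ite State.go
        (.seq (alter .z .y fun g => { g with held := false })
          (.seq (alter .x .y fun g => { g with held := true })
            (.load fun q => { q with want := false })))
        skip)))
    (P := fun i q mem => ∃ s', Rep A b N mem s' ∧ ReflTransGen (Step A b) s s' ∧ Frame x y s s' ∧
      if q.want then s' = s ∧ ((x, y) ∈ A ∧ (x, y) ∉ s.H ∧ row s.H x < b x ∧ 2 ≤ col s.H y) ∧
        ∀ z < i, (z, y) ∈ s.H → s.lev x ≤ s.lev z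
      else Blocked A b s' x y)
    (by simp [Keeps])
    ⟨s, h, .refl, .refl _ _ _, by
      revert hw
      split_ifs
      · exact fun hw => ⟨rfl, hw, by simp⟩
      · exact id⟩ (by
      rintro i hi e' hz hreg ⟨s', hs', hst, hf, hw'⟩
      have hx' : e'.reg .x = x := hreg .x (by decide)
        (by simp [Keeps])
      have hy' : e'.reg .y = y := hreg .y (by decide)
        (by simp [Keeps])
      obtain ⟨hm, hcw, hlt⟩ := hs'.eval_compare (hx'.trans_lt hx) (hz.trans_lt hi)
      have hkeep : ∀ u, u ≠ .l → (compare.eval N e').reg u = e'.reg u := fun u hu =>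
        Keeps.reg_eval (keeps_compare.2 hu) e'
      have hrx := (hkeep .x (by decide)).trans hx'
      have hry := (hkeep .y (by decide)).trans hy'
      have hrz := (hkeep .z (by decide)).trans hz
      rw [hx', hz] at hlt
      have hheld := hs'.held i hi y hy
      simp only [Prog.eval, eval_look, eval_skip, eval_alter, hrx, hry, hrz, hm, hcw, hlt]
      rcases hgo : e'.q.want && decide (s'.lev i < s'.lev x) && (e'.mem i y).held with _ | _
      · refine ⟨s', by simpa [hm] using hs', hst, hf, ?_⟩
        simp only [Bool.false_eq_true, if_false]
        revert hw'
        split_ifs with hwt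
        · rintro ⟨rfl, hw₁, hw₂⟩
          refine ⟨rfl, hw₁, fun z hz hzy => ?_⟩
          rcases Nat.lt_succ_iff_lt_or_eq.1 hz with hz | rfl
          · exact hw₂ z hz hzy
          · simpa [hwt, hheld.2 hzy] using hgo
        · exact id
      · simp only [Bool.and_eq_true, decide_eq_true_eq] at hgo
        obtain ⟨⟨hwt, hl⟩, hh⟩ := hgo
        rw [if_pos hwt] at hw'
        obtain ⟨rfl, ⟨hA, hH, hr, hc⟩, -⟩ := hw'
        have hiy : (i, y) ∈ s'.H := hheld.1 hh
        refine ⟨⟨insert (x, y) (s'.H.erase (i, y)), s'.lev⟩,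
          by simpa using (hs'.clearHeld i y).setHeld hx hy, .single ?_, ⟨rfl, ?_, ?_⟩, ?_⟩
        · exact .swap hA hH hr hiy hl
        · intro y' hy' z
          simp [hy']
        · intro y' hxy
          have : (x, y') ≠ (i, y) := by
            rintro h
            exact hH (by rw [(Prod.mk.inj h).1]; exact hiy)
          exact Finset.mem_insert_of_mem (Finset.mem_erase.2 ⟨this, hxy⟩)
        · simp [Blocked])
  refine ⟨s', hs', hst, hf, ?_⟩
  revert hw'
  split_ifs
  · rintro ⟨rfl, hw₁, hw₂⟩ - - -
    exact ⟨hw₁.2.2.2, fun z hz => hw₂ z (hs'.held_lt _ _ hz).1 hz⟩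
  · exact id

theorem Rep.eval_tryEdge (h : Rep A b N e.mem s) (ho : e.reg .o = 0) (hx : e.reg .x < N)
    (hy : e.reg .y < N) :
    ∃ s', Rep A b N (tryEdge.eval N e).mem s' ∧ ReflTransGen (Step A b) s s' ∧
      Frame (e.reg .x) (e.reg .y) s s' ∧ Blocked A b s' (e.reg .x) (e.reg .y) := by
  obtain ⟨hm₁, k₁, hk₁, hq₁⟩ := h.eval_computeNeed ho hx
  set e₁ := computeNeed.eval N e with he₁
  have hr₁ : ∀ u, u ≠ .c → e₁.reg u = e.reg u := fun u hu =>
    Keeps.reg_eval (keeps_computeNeed.2 hu) e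
  have h₁ : Rep A b N e₁.mem s := by rwa [hm₁]
  have hx₁ := hr₁ .x (by decide)
  have hy₁ := hr₁ .y (by decide)
  obtain ⟨hm₂, k₂, hk₂, hq₂⟩ := h₁.eval_computeCount (hy₁.trans_lt hy)
  set e₂ := computeCount.eval N e₁ with he₂
  have hr₂ : ∀ u, u ≠ .z → e₂.reg u = e₁.reg u := fun u hu =>
    Keeps.reg_eval (keeps_computeCount.2 hu) e₁
  have hx₂ := (hr₂ .x (by decide)).trans hx₁
  have hy₂ := (hr₂ .y (by decide)).trans hy₁
  have hm : e₂.mem = e.mem := hm₂.trans hm₁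
  rw [hy₁] at hk₂
  set x := e.reg .x
  set y := e.reg .y
  set e₃ : Env Reg State Cell := { e₂ with q := { e₂.q with
    want := decide (e₂.q.need ≠ 0) && (e.mem x y).adj && !(e.mem x y).held } } with he₃
  have heval : tryEdge.eval N e = if e₃.q.want && decide (e₃.q.cnt ≠ 2) then
      { e₃ with mem := set e.mem x y { e.mem x y with held := true } }
      else search.eval N e₃ := by
    simp only [tryEdge, Prog.eval, eval_look, eval_alter, ← he₁, ← he₂, hx₂, hy₂, hm,
      he₃]
  have hneed : e₂.q.need ≠ 0 ↔ row s.H x < b x := by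
    rw [hq₂, hq₁, Ne, Fin.ext_iff]
    simp only [hk₁, Fin.val_zero]
    omega
  have hcnt : e₂.q.cnt ≠ 2 ↔ col s.H y < 2 := by
    rw [hq₂, Ne, Fin.ext_iff]
    simp only [hk₂, Fin.val_two]
    omega
  have hwant : e₃.q.want = true ↔ row s.H x < b x ∧ (x, y) ∈ A ∧ (x, y) ∉ s.H := by
    simp [he₃, hneed, h.adj x hx y hy, ← h.held x hx y hy, and_assoc]
  rw [heval]
  split_ifs with hc
  · simp only [Bool.and_eq_true, decide_eq_true_eq] at hc
    obtain ⟨hr, hA, hH⟩ := hwant.1 hc.1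
    refine ⟨_, h.setHeld hx hy, .single (.add hA hH hr (hcnt.1 hc.2)), ⟨rfl, ?_, ?_⟩, ?_⟩
    · intro y' hy' z
      simp [hy']
    · exact fun y' h => Finset.mem_insert_of_mem h
    · simp [Blocked]
  · simp only [Bool.and_eq_true, decide_eq_true_eq, not_and] at hc
    have h₃ : Rep A b N e₃.mem s := by simpa only [he₃, hm] using h
    have := h₃.eval_search (hx₂.trans_lt hx) (hy₂.trans_lt hy)
    simp only [he₃, hx₂, hy₂] at this
    refine this ?_
    split_ifs with hw
    · obtain ⟨hr, hA, hH⟩ := hwant.1 hw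
      exact ⟨hA, hH, hr, not_lt.1 (mt hcnt.2 (hc hw))⟩
    · exact fun hA hH hr => absurd (hwant.2 ⟨hr, hA, hH⟩) hw

/-- The levels are kept in unary, so setting the first unset bit increases the level. A level that
has reached `N` cannot be increased. -/
theorem Rep.eval_raise (h : Rep A b N e.mem s) (hx : e.reg .x < N) :
    Rep A b N (raise.eval N e).mem s ∧ s.lev (e.reg .x) = N ∨
      Rep A b N (raise.eval N e).mem
        ⟨s.H, Function.update s.lev (e.reg .x) (s.lev (e.reg .x) + 1)⟩ := by
  set x := e.reg .x with hxdef
  have key := (eval_each (N := N) (v := Reg.l) (e := { e with q := { e.q with flag := true } })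
    (a := .act .x .l fun (q : State) (g : Cell) =>
      ({ q with flag := q.flag && g.lev }, { g with lev := g.lev || q.flag }))
    (P := fun i q mem => q.flag = decide (i ≤ s.lev x) ∧ mem = if i ≤ s.lev x then e.mem else
      set e.mem x (s.lev x) { e.mem x (s.lev x) with lev := true })
    trivial (by simp) (by
      rintro i hi e' hl hreg ⟨hf, hm⟩
      have hx' : e'.reg .x = x := hreg .x (by decide) trivial
      have hlev := h.lev x hx i hi
      simp only [Prog.eval, hl, hx']
      change _ ∧ set e'.mem x i _ = _
      rcases lt_trichotomy i (s.lev x) with hlt | rfl | hlt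
      · rw [if_pos hlt.le] at hm
        rw [if_pos (by omega), hf, hm]
        have hl' := hlev.2 hlt
        refine ⟨by simp [hl', hlt, hlt.le], ?_⟩
        convert set_self e.mem x i using 2
        cases hg : e.mem x i
        simp_all
      · rw [if_pos le_rfl] at hm
        rw [if_neg (by omega), hf, hm]
        have hl' : (e.mem x (s.lev x)).lev = false := by simpa using hlev
        simp [hl']
      · rw [if_neg (by omega)] at hm
        rw [if_neg (by omega), hf, hm]
        have h₁ : ¬ i ≤ s.lev x := by omega
        have h₂ : ¬ i + 1 ≤ s.lev x := by omega
        simp only [h₁, h₂, decide_false, Bool.false_and, Bool.or_false, true_and]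
        exact set_self _ x i)).2
  change (raise.eval N e).mem = _ at key
  rw [key]
  split_ifs with hN
  · exact Or.inl ⟨h, le_antisymm (h.lev_le x) hN⟩
  · exact Or.inr (h.setLev (not_le.1 hN))

/-- A turn of `x` consists of steps of the algorithm. If `x` has not enough edges, there is at least
one: when all edges at `x` are blocked, the level of `x` increases. -/
theorem Rep.eval_turn (h : Rep A b N e.mem s) (hs : Inv A b s) (ho : e.reg .o = 0)
    (hx : e.reg .x < N) :
    ∃ s', Rep A b N (turn.eval N e).mem s' ∧ ReflTransGen (Step A b) s s' ∧
      (row s.H (e.reg .x) < b (e.reg .x) → s.lev (e.reg .x) < N → TransGen (Step A b) s s') := by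
  set x := e.reg .x with hxdef
  obtain ⟨s', hs', hst, hlev, hb⟩ := eval_each (N := N) (v := Reg.y) (e := e)
    (a := tryEdge)
    (P := fun i _ mem => ∃ s', Rep A b N mem s' ∧ ReflTransGen (Step A b) s s' ∧ s'.lev = s.lev ∧
      ∀ y < i, Blocked A b s' x y)
    (by simp)
    ⟨s, h, .refl, rfl, by simp⟩ (by
      rintro i hi e' hy hreg ⟨s', hs', hst, hlev, hb⟩
      have hx' : e'.reg .x = x := hreg .x (by decide) (by
        simp)
      have ho' : e'.reg .o = 0 := (hreg .o (by decide) (by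
        simp)).trans ho
      obtain ⟨s₂, h₂, hst₂, hf, hb₂⟩ := hs'.eval_tryEdge ho' (hx'.trans_lt hx) (hy.trans_lt hi)
      rw [hx', hy] at hf hb₂
      refine ⟨s₂, h₂, hst.trans hst₂, hf.lev_eq.trans hlev, fun y hy => ?_⟩
      rcases Nat.lt_succ_iff_lt_or_eq.1 hy with hy | rfl
      · exact hf.blocked hy.ne (hb y hy)
      · exact hb₂)
  set e₁ := (Prog.each Reg.y tryEdge).eval N e with he₁
  have hr₁ : ∀ u, (u = .x ∨ u = .o) → e₁.reg u = e.reg u := fun u hu => Keeps.reg_eval (by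
    rcases hu with rfl | rfl <;>
    simp [Keeps]) e
  have hx₁ : e₁.reg .x = x := hr₁ .x (.inl rfl)
  obtain ⟨hm₂, k, hk, hq₂⟩ := hs'.eval_computeNeed ((hr₁ .o (.inr rfl)).trans ho) (hx₁.trans_lt hx)
  set e₂ := computeNeed.eval N e₁ with he₂
  have hx₂ : e₂.reg .x = x := (Keeps.reg_eval
    (by simp) e₁).trans hx₁
  have hneed : e₂.q.need ≠ 0 ↔ row s'.H x < b x := by
    rw [hq₂, Ne, Fin.ext_iff]
    simp only [hk, hx₁, Fin.val_zero]
    omega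
  have hs₂ : Rep A b N e₂.mem s' := by rwa [hm₂]
  have hsI : Inv A b s' := by
    clear hs' hlev hb hneed hs₂ hk
    induction hst with
    | refl => exact hs
    | tail _ h ih => exact ih.step h
  have heval : turn.eval N e = if decide (e₂.q.need ≠ 0) then
    raise.eval N e₂ else e₂ := rfl
  rw [heval]
  simp only [decide_eq_true_eq, hneed]
  split_ifs with hdef
  · have hraise : Step A b s' ⟨s'.H, Function.update s'.lev x (s'.lev x + 1)⟩ := by
      refine .raise hdef fun y hA hH => ?_
      obtain ⟨h₁, h₂⟩ := hb y (h.edge_lt _ _ hA).2 hA hH hdef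
      exact ⟨le_antisymm (hsI.col_le y) h₁, h₂⟩
    rcases hs₂.eval_raise (hx₂.trans_lt hx) with ⟨h₁, h₂⟩ | h₁
    · exact ⟨s', h₁, hst, fun _ hl => by rw [hx₂, hlev] at h₂; omega⟩
    · rw [hx₂] at h₁
      exact ⟨_, h₁, hst.tail hraise, fun _ _ => .tail' hst hraise⟩
  · -- `x` got its edges in this turn, so the stage has changed
    refine ⟨s', hs₂, hst, fun hr _ => ?_⟩
    rcases reflTransGen_iff_eq_or_transGen.1 hst with rfl | hst
    · exact absurd hr hdef
    · exact hst

theorem Rep.eval_final (h : Rep A b N e.mem s) (ho : e.reg .o = 0) :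
    (final.eval N e).q.ok = true ↔ ∀ x < N, b x ≤ row s.H x := by
  refine (eval_each (N := N) (v := Reg.x) (e := { e with q := { e.q with ok := true } })
    (a := .seq computeNeed
      (.load fun q : State => { q with ok := q.ok && decide (q.need = 0) }))
    (P := fun i q mem => (q.ok = true ↔ ∀ x < i, b x ≤ row s.H x) ∧ mem = e.mem)
    (by simp [Keeps]) (by simp) (by
      rintro i hi e' hx hreg ⟨hok, hm⟩
      have ho' : e'.reg .o = 0 := (hreg .o (by decide)
        (by simp [Keeps])).trans ho
      have h' : Rep A b N e'.mem s := by rwa [hm]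
      obtain ⟨hm', k, hk, hq⟩ := h'.eval_computeNeed ho' (hx.trans_lt hi)
      simp only [Prog.eval, hm', hq]
      refine ⟨?_, hm⟩
      have hk0 : k = 0 ↔ b i ≤ row s.H i := by
        rw [Fin.ext_iff, hk, hx, Fin.val_zero]
        omega
      simp only [Bool.and_eq_true, decide_eq_true_eq, hok, hk0]
      exact Nat.forall_lt_succ_right.symm)).1

/-- A round makes a step, unless all vertices have enough edges. -/
theorem Rep.eval_round (h : Rep A b N e.mem s) (hs : Reached A b m s) (hb : ∀ x, m ≤ x → b x = 0)
    (hm : m ≤ N) (ho : e.reg .o = 0) :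
    ∃ s', Rep A b N ((Prog.each .x turn).eval N e).mem s' ∧ ReflTransGen (Step A b) s s' ∧
      ∀ x, row s.H x < b x → s.lev x < m → TransGen (Step A b) s s' := by
  obtain ⟨s', h', hst, hx⟩ := eval_each (N := N) (v := Reg.x) (e := e)
    (a := turn)
    (P := fun i _ mem => ∃ s', Rep A b N mem s' ∧ ReflTransGen (Step A b) s s' ∧
      ∀ x < i, row s.H x < b x → s.lev x < m → TransGen (Step A b) s s')
    (by simp)
    ⟨s, h, .refl, by simp⟩ (by
      rintro i hi e' hx hreg ⟨s', h', hst, hx'⟩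
      have ho' : e'.reg .o = 0 := (hreg .o (by decide) (by
        simp)).trans ho
      obtain ⟨s₂, h₂, hst₂, hx₂⟩ := h'.eval_turn (hs.steps hb hst).inv ho' (hx.trans_lt hi)
      refine ⟨s₂, h₂, hst.trans hst₂, fun x hxi hr hl => ?_⟩
      rcases Nat.lt_succ_iff_lt_or_eq.1 hxi with hxi | rfl
      · exact (hx' x hxi hr hl).trans_left hst₂
      · rcases reflTransGen_iff_eq_or_transGen.1 hst with rfl | hst
        · rw [hx] at hx₂
          exact hx₂ hr (hl.trans_le hm)
        · exact hst.trans_left hst₂)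
  refine ⟨s', h', hst, fun x hr hl => hx x ?_ hr hl⟩
  by_contra hxN
  rw [hb x (by omega)] at hr
  omega

/-- After `N ^ 2` rounds the potential is at least `N ^ 2`, unless there is no solution or all
vertices have enough edges. -/
theorem Rep.eval_rounds (h : Rep A b N e.mem ⟨∅, fun _ => 0⟩) (hb : ∀ x, m ≤ x → b x = 0)
    (hm : m ≤ N) (ho : e.reg .o = 0) :
    ∃ s', Rep A b N ((Prog.each .r₁ (.each .r₂ (.each .x turn))).eval N e).mem s' ∧
      Reached A b m s' ∧
      ((∃ F, IsSolution A b F) → Satisfied b s' ∨ N * N ≤ potential m s') := by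
  refine eval_each (N := N) (v := Reg.r₁) (e := e)
    (P := fun i _ mem => ∃ s', Rep A b N mem s' ∧ Reached A b m s' ∧
      ((∃ F, IsSolution A b F) → Satisfied b s' ∨ i * N ≤ potential m s'))
    (by simp [Keeps])
    ⟨_, h, reached_empty A b m, fun _ => .inr (by simp)⟩ ?_
  rintro i hi e₁ - hreg₁ ⟨s₁, h₁, hs₁, hp₁⟩
  have ho₁ : e₁.reg .o = 0 := (hreg₁ .o (by decide) (by
    simp [Keeps])).trans ho
  rw [Nat.succ_mul]
  refine eval_each (N := N) (v := Reg.r₂) (e := e₁)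
    (P := fun j _ mem => ∃ s', Rep A b N mem s' ∧ Reached A b m s' ∧
      ((∃ F, IsSolution A b F) → Satisfied b s' ∨ i * N + j ≤ potential m s'))
    (by simp [Keeps])
    ⟨s₁, h₁, hs₁, hp₁⟩ ?_
  rintro j hj e₂ - hreg₂ ⟨s₂, h₂, hs₂, hp₂⟩
  have ho₂ : e₂.reg .o = 0 := (hreg₂ .o (by decide) (by
    simp [Keeps])).trans ho₁
  obtain ⟨s₃, h₃, hst, htrans⟩ := h₂.eval_round hs₂ hb hm ho₂
  exact ⟨s₃, h₃, hs₂.steps hb hst, fun hsol => hs₂.progress hb hsol hst htrans (hp₂ hsol)⟩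

/-! ### Reading the input -/

/-- The memory cell `(x, y)` after the input has been read. -/
def cell (A : Finset (ℕ × ℕ)) (b : ℕ → ℕ) (x y : ℕ) : Cell where
  adj := decide ((x, y) ∈ A)
  held := false
  lev := false
  ex := decide (y = 0 ∧ b x ≠ 0)
  inS := decide (y = 0 ∧ b x = 2)

theorem rep_cell (hA : ∀ x y, (x, y) ∈ A → x < N ∧ y < N) (hb : ∀ x, b x ≤ 2) :
    Rep A b N (cell A b) ⟨∅, fun _ => 0⟩ where
  edge_lt := hA
  held_lt := by simp
  lev_le := by simp
  adj := by simp [cell]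
  held := by simp [cell]
  lev := by simp [cell]
  demand x _ := by
    have := hb x
    interval_cases h : b x <;> simp [cell, Cell.demand, h]

/-- The memory when `i` rows of the input have been read. -/
def rowsRead (A : Finset (ℕ × ℕ)) (b : ℕ → ℕ) (i x y : ℕ) : Cell :=
  if x < i then cell A b x y else default

/-- The memory when `i` rows of the input and the first `k` entries of row `i` have been read. -/
def entriesRead (A : Finset (ℕ × ℕ)) (b : ℕ → ℕ) (i k x y : ℕ) : Cell :=
  if x = i then { cell A b x y with adj := decide ((x, y) ∈ A ∧ y < k) } else rowsRead A b i x y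

theorem set_rowsRead {i : ℕ} (hi : b i ≠ 0) : set (rowsRead A b i) i 0
    { rowsRead A b i i 0 with ex := true, inS := decide (b i = 2) } = entriesRead A b i 0 := by
  funext x y
  rw [set_apply, entriesRead]
  by_cases hx : x = i
  · subst hx
    by_cases hy : y = 0
    · subst hy
      simp [rowsRead, cell, hi, default]
    · simp [rowsRead, cell, hy, default]
  · simp [hx]

theorem set_entriesRead (i k : ℕ) : set (entriesRead A b i k) i k
    { entriesRead A b i k i k with adj := decide ((i, k) ∈ A) } = entriesRead A b i (k + 1) := by
  funext x y
  rw [set_apply]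
  by_cases hx : x = i
  · subst hx
    by_cases hy : y = k
    · subst hy
      simp [entriesRead]
    · have : y < k + 1 ↔ y < k := by omega
      simp [entriesRead, hy, this]
  · simp [entriesRead, hx]

theorem entriesRead_eq {n i : ℕ} (hA : ∀ x y, (x, y) ∈ A → y < n) :
    entriesRead A b i n = rowsRead A b (i + 1) := by
  funext x y
  have : (x, y) ∈ A ∧ y < n ↔ (x, y) ∈ A := and_iff_left_of_imp (hA x y)
  rcases lt_trichotomy x i with h | rfl | h
  · simp [entriesRead, rowsRead, h.ne, h, h.trans (Nat.lt_succ_self i)]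
  · simp [entriesRead, rowsRead, this, cell]
  · have h₁ : ¬ x < i + 1 := by omega
    simp [entriesRead, rowsRead, h.ne', h.not_gt, h₁]

/-- One pass of the loop that reads the input. -/
def pass (N : ℕ) (e : Env Reg State Cell) : Env Reg State Cell :=
  { parse.eval N e with
    reg := Function.update (parse.eval N e).reg .p (min ((parse.eval N e).reg .p + 1) N) }

/-- What matters about the situation while the input is being read. -/
structure Reading (ph : Phase) (i : ℕ) (mem : ℕ → ℕ → Cell) (w : List (Option Bool))
    (e : Env Reg State Cell) : Prop where
  phase : e.q.phase = ph
  x : e.reg .x = i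
  o : e.reg .o = 0
  mem : e.mem = mem
  inp : e.inp = w

variable {i j : ℕ} {w : List (Option Bool)} {c : Bool}

theorem Reading.header_some (h : Reading .header i mem (some c :: w) e) :
    Reading .header i mem w (pass N e) := by
  constructor <;> simp [pass, parse, Prog.eval, h.phase, h.x, h.o, h.mem, h.inp]

theorem Reading.header_none (h : Reading .header i mem (none :: w) e) :
    Reading .start i mem w (pass N e) := by
  constructor <;> simp [pass, parse, Prog.eval, h.phase, h.x, h.o, h.mem, h.inp]

theorem Reading.start_some (h : Reading .start i mem (some c :: w) e) :
    Reading .row i (set mem i 0 { mem i 0 with ex := true, inS := c }) w (pass N e) ∧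
      (pass N e).reg .y = 0 := by
  refine ⟨?_, by simp [pass, parse, Prog.eval, h.phase]⟩
  constructor <;> simp [pass, parse, Prog.eval, h.phase, h.x, h.o, h.mem, h.inp, Prog.set]

theorem Reading.row_some (h : Reading .row i mem (some c :: w) e) (hy : e.reg .y = j)
    (hj : j < N) :
    Reading .row i (set mem i j { mem i j with adj := c }) w (pass N e) ∧
      (pass N e).reg .y = j + 1 := by
  refine ⟨?_, ?_⟩
  · constructor <;> simp [pass, parse, Prog.eval, h.phase, h.x, h.o, h.mem, h.inp, hy, Prog.set]
  · simp [pass, parse, Prog.eval, h.phase, h.inp, hy]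
    omega

theorem Reading.row_none (h : Reading .row i mem (none :: w) e) (hi : i < N) :
    Reading .start (i + 1) mem w (pass N e) := by
  constructor <;> simp [pass, parse, Prog.eval, h.phase, h.x, h.o, h.mem, h.inp]
  omega

theorem Reading.header (n : ℕ)
    (h : Reading .header i mem (List.replicate n (some c) ++ none :: w) e) :
    Reading .start i mem w ((pass N)^[n + 1] e) := by
  induction n generalizing e with
  | zero => exact h.header_none
  | succ n ih => exact ih h.header_some

open SDMInstance in
theorem Reading.encodeRow {I : SDMInstance} {k : Fin I.m} (hm : I.m ≤ N) (hn : I.n ≤ N)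
    (h : Reading .start k (rowsRead I.edges I.demand k) (I.encodeRow k ++ w) e) :
    Reading .start (k + 1) (rowsRead I.edges I.demand (k + 1)) w ((pass N)^[I.n + 2] e) := by
  classical
  have hd : I.demand k = if k ∈ I.S then 2 else 1 := by simp [SDMInstance.demand]
  have hentries : ∀ j ≤ I.n, Reading .row k (entriesRead I.edges I.demand k j)
      ((List.ofFn (fun j : Fin I.n => some (decide (I.graph.Adj (.inl k) (.inr j))))).drop j ++
        none :: w) ((pass N)^[j + 1] e) ∧ ((pass N)^[j + 1] e).reg .y = j := by
    intro j
    induction j with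
    | zero =>
      intro _
      rw [← set_rowsRead (by rw [hd]; split_ifs <;> simp)]
      have h' : decide (I.demand k = 2) = decide (k ∈ I.S) := by
        rw [hd]; split_ifs <;> simp [*]
      rw [h']
      refine Reading.start_some (e := e) ?_
      simpa [SDMInstance.encodeRow] using h
    | succ j ih =>
      intro hj
      obtain ⟨h₁, h₂⟩ := ih (by omega)
      rw [List.drop_eq_getElem_cons (by simpa using hj), List.getElem_ofFn, List.cons_append] at h₁
      rw [Function.iterate_succ_apply', ← set_entriesRead]
      have h' : decide ((↑k, j) ∈ I.edges) = decide (I.graph.Adj (.inl k) (.inr ⟨j, hj⟩)) :=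
        decide_eq_decide.2 (mem_pairs (j := ⟨j, hj⟩))
      rw [h']
      exact h₁.row_some h₂ (by omega)
  obtain ⟨h₁, -⟩ := hentries I.n le_rfl
  rw [List.drop_of_length_le (by simp), List.nil_append] at h₁
  rw [Function.iterate_succ_apply', ← entriesRead_eq (n := I.n)]
  · exact h₁.row_none (k.2.trans_le hm)
  · intro x y hxy
    obtain ⟨i, j, hp, -⟩ := exists_of_mem_pairs hxy
    rw [(Prod.mk.inj hp).2]
    exact j.2

open SDMInstance in
theorem Reading.encode {I : SDMInstance} (hm : I.m ≤ N) (hn : I.n ≤ N)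
    (h : Reading .header 0 (fun _ _ => default) I.encode e) :
    Reading .start I.m (cell I.edges I.demand) [] ((pass N)^[I.encode.length] e) := by
  have hrows : ∀ i ≤ I.m, Reading .start i (rowsRead I.edges I.demand i)
      ((List.ofFn I.encodeRow).drop i).flatten
      ((pass N)^[i * (I.n + 2)] ((pass N)^[I.n + 1] e)) := by
    intro i
    induction i with
    | zero =>
      intro _
      have hmem : rowsRead I.edges I.demand 0 = fun _ _ => default := by
        funext x y; simp [rowsRead]
      rw [hmem, Nat.zero_mul]
      refine Reading.header (c := true) I.n ?_
      simpa [SDMInstance.encode] using h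
    | succ i ih =>
      intro hi
      have h₁ := ih (by omega)
      rw [List.drop_eq_getElem_cons (by simpa using hi), List.getElem_ofFn, List.flatten_cons] at h₁
      rw [Nat.succ_mul, Nat.add_comm (i * _), Function.iterate_add_apply]
      exact Reading.encodeRow (k := ⟨i, hi⟩) hm hn h₁
  have h₁ := hrows I.m le_rfl
  rw [List.drop_of_length_le (by simp), List.flatten_nil, ← Function.iterate_add_apply, Nat.add_comm,
    ← length_encode] at h₁
  have hmem : rowsRead I.edges I.demand I.m = cell I.edges I.demand := by
    funext x y
    unfold rowsRead
    split_ifs with hx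
    · rfl
    · have hA : (x, y) ∉ I.edges := fun hxy => by
        obtain ⟨i, j, hp, -⟩ := exists_of_mem_pairs hxy
        exact hx ((Prod.mk.inj hp).1 ▸ i.2)
      simp [cell, hA, SDMInstance.demand, hx, default]
  rwa [hmem] at h₁

/-! ### The decision problem is in polynomial time -/

open SDMInstance in
/-- The program decides whether there is an `S`-pair. -/
theorem main_correct {I : SDMInstance} (hI : I.IsLarge) :
    (main.eval I.encode.length ⟨default, fun _ => 0, fun _ _ => default, I.encode⟩).q.ok = true ↔
      I.IsYes := by
  set N := I.encode.length with hN
  have hlen : N = (I.n + 1) + I.m * (I.n + 2) := I.length_encode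
  have hmN : 2 * I.m + 1 ≤ N := by rw [hlen]; nlinarith
  have hnN : I.n < N := by rw [hlen]; omega
  have hb : ∀ x, I.m ≤ x → I.demand x = 0 := fun x hx => dif_neg (by omega)
  have hb₂ : ∀ x, I.demand x ≤ 2 := fun x => by
    unfold SDMInstance.demand
    split_ifs <;> simp
  have hA : ∀ x y, (x, y) ∈ I.edges → x < N ∧ y < N := fun x y hxy => by
    obtain ⟨i, j, hp, -⟩ := exists_of_mem_pairs hxy
    obtain ⟨rfl, rfl⟩ := Prod.mk.inj hp
    have := i.2
    have := j.2
    omega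
  have h₁ := Reading.encode (N := N) (I := I) (e := ⟨default, Function.update (fun _ => 0) Reg.p 0,
    fun _ _ => default, I.encode⟩) (by omega) hnN.le ⟨rfl, rfl, rfl, rfl, rfl⟩
  set e₁ := (Prog.each .p parse).eval N ⟨default, fun _ => 0, fun _ _ => default, I.encode⟩ with he₁
  change Reading .start I.m _ [] e₁ at h₁
  have hrep : Rep I.edges I.demand N e₁.mem ⟨∅, fun _ => 0⟩ := by
    rw [h₁.mem]
    exact rep_cell hA hb₂
  obtain ⟨s, hs, hr, hsol⟩ := hrep.eval_rounds (m := I.m) hb (by omega) h₁.o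
  set e₂ := (Prog.each .r₁ (.each .r₂ (.each .x turn))).eval N e₁ with he₂
  have ho₂ : e₂.reg .o = 0 := (Keeps.reg_eval (by
    simp [Keeps]) e₁).trans h₁.o
  have hfinal := hs.eval_final ho₂
  change (final.eval N e₂).q.ok = true ↔ _
  rw [hfinal, isYes_iff_exists_isSolution hI]
  constructor
  · intro h
    refine ⟨_, hr.isSolution fun x => ?_⟩
    rcases lt_or_ge x N with hx | hx
    · exact h x hx
    · rw [hb x (by omega)]
      exact Nat.zero_le _
  · -- `N ≥ 2 * m + 1`, hence `N ^ 2 > 3 * m ^ 2 + 2 * m`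
    exact fun h x _ => hr.satisfied hb hb₂ h (hsol h) (by nlinarith) x

end SDMProgram

theorem mainTheorem3 :
    Nonempty (Turing.TM2ComputableInPolyTime
      (fun I : {I : SDMInstance // I.IsLarge} => I.1.encode)
      Computability.encodeBool SDMInstance.answer) ∧
    ∀ I : SDMInstance, I.IsLarge →
      (I.IsYes ↔ ∃ H : I.graph.Subgraph, IsFactor I.lower I.upper H) := by
  refine ⟨StackProgram.Prog.nonempty_tm2ComputableInPolyTime SDMProgram.main
    SDMProgram.main_wellFormed default SDMProgram.State.ok _ _ fun I => ?_,
    fun I hI => SDMInstance.isYes_iff_exists_isFactor hI⟩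
  classical
  rw [Bool.eq_iff_iff, SDMInstance.answer, decide_eq_true_iff]
  exact SDMProgram.main_correct I.2
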